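/- Let $d\ge 1$, $\mathbb H=\{i\in\mathbb Z^d: i_d\ge 1\}$, write $i\sim j$ if $\sum_k|i_k-j_k|=1$, and for $n\ge 0$ let $\Lambda_n=\{i\in\mathbb Z^d: 1\le i_d\le n,\ |i_k|\le n \text{ for } k<d\}$, let $W_n=[-n,n]^{d-1}\times\{1\}$, and let $\Delta_n$ be the union of $\Lambda_n$ and its reflection under $i_d\mapsto 1-i_d$. Let $J\ge 0$, $\lambda\ge 0$, and let $(h_\ell)_{\ell\ge1}$ be a summable sequence of positive real numbers. For $\epsilon\in\{+,-\}$, let $$Z_n^{\epsilon}=\sum_{\sigma}\exp\Big\{\sum_{\{i,j\}\subset\mathbb H,\ i\sim j,\ \{i,j\}\cap\Lambda_n\ne\emptyset}J\sigma_i\sigma_j+\sum_{i\in\Lambda_n}h_{i_d}\sigma_i+\lambda\sum_{i\in\Lambda_n,\ i_d=1}\sigma_i\Big\}$$ be the partition function of the semi-infinite Ising model, where the sum is over $\sigma\in\{\pm1\}^{\mathbb Z^d}$ with $\sigma_i=\epsilon1$ for $i\notin\Lambda_n$, and let $$Q_n^{\epsilon}=\sum_{\sigma}\exp\{-H_n(\sigma)\},\qquad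 H_n(\sigma)=-\sum_{i\sim j,\ \{i,j\}\cap\Delta_n\neq\emptyset}J\sigma_i\sigma_j,$$ where the sum is over $\sigma$ with $\sigma_i=\epsilon1$ for $i\notin\Delta_n$ (each edge $\{i,j\}$ being counted once). Put $h'_1=h_1+\lambda$ and $h'_\ell=h_\ell$ for $\ell\ge2$; let $\overline h_i=h'_{i_d}$ if $i_d\ge1$ and $\overline h_i=h'_{1-i_d}$ if $i_d\le0$; let $e_d$ be the last canonical vector. For $t\in[0,1]$ let $\langle\cdot\rangle_{n}^{\epsilon}(t)$ be the Gibbs expectation in $\Delta_n$ with boundary condition $\epsilon1$ and Hamiltonian $$H_n(\sigma)+t\Big(\sum_{i\in W_n}J\sigma_i\sigma_{i-e_d}-\sum_{i\in\Delta_n}\overline h_i\sigma_i\Big).$$ Then, for both $\epsilon=+$ and $\epsilon=-$, the surface free energy $$F^{\epsilon}(J,\lambda,h)=\lim_{n\to\infty}-\frac1{2|W_n|}\ln\left[\frac{(Z_n^{\epsilon})^2}{Q_n^{\epsilon}}\right]$$ exists as a real number. Moreover, for every $t\in[0,1]$ and every function $f$ of finitely many spins the limit $\langle f\rangle^{\epsilon}(t)=\lim_{n\to\infty}\langle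 f\rangle^{\epsilon}_n(t)$ exists, and $$F^{\epsilon}(J,\lambda,h)=\frac12\left[\int_0^1J\langle\sigma_{e_d}\sigma_0\rangle^{\epsilon}(t)\,dt-\sum_{\ell=1}^{\infty}\int_0^1h'_\ell\Big(\langle\sigma_{\ell e_d}\rangle^{\epsilon}(t)+\langle\sigma_{-(\ell-1)e_d}\rangle^{\epsilon}(t)\Big)dt\right],$$ where all the integrands are integrable on $[0,1]$ and the series converges; moreover, for every $t\in[0,1]$ the series $\sum_{\ell\ge1}h'_\ell(\langle\sigma_{\ell e_d}\rangle^{\epsilon}(t)+\langle\sigma_{-(\ell-1)e_d}\rangle^{\epsilon}(t))$ converges, and $$F^{\epsilon}(J,\lambda,h)=\frac12\int_0^1\left[J\langle\sigma_{e_d}\sigma_0\rangle^{\epsilon}(t)-\sum_{\ell=1}^{\infty}h'_\ell\Big(\langle\sigma_{\ell e_d}\rangle^{\epsilon}(t)+\langle\sigma_{-(\ell-1)e_d}\rangle^{\epsilon}(t)\Big)\right]dt,$$ the integrand again being integrable on $[0,1]$. -/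

import Mathlib

open MeasureTheory Filter Topology

namespace SemiInfiniteIsing

noncomputable section

/-- Sites of the lattice `ℤ^d`, where `d = m + 1 ≥ 1`. The last coordinate `i_d` is `i (Fin.last m)`. -/
abbrev Site (m : ℕ) := Fin (m + 1) → ℤ

/-- Spin configurations on `ℤ^d`; the two units of `ℤ` are the spins `+1` and `-1`. -/
abbrev Config (m : ℕ) := Site m → ℤˣ

variable {m : ℕ}

/-- The spin `σ_i`, as a real number. -/
def spin (i : Site m) (σ : Config m) : ℝ := ((σ i : ℤ) : ℝ)

/-- The canonical vector `e_d`. -/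
def lastVec (m : ℕ) : Site m := Pi.single (Fin.last m) 1

/-- The nearest-neighbour lattice: `i ∼ j` when their `ℓ¹`-distance is one. -/
def lattice (m : ℕ) : SimpleGraph (Site m) where
  Adj i j := ∑ k, |i k - j k| = 1
  symm := ⟨fun i j hij => by simpa only [abs_sub_comm] using hij⟩
  loopless := ⟨fun i hi => by simp at hi⟩

/-- The half-space `i_d ≥ 1`. -/
def halfSpace (m : ℕ) : Set (Site m) := {i | 1 ≤ i (Fin.last m)}

open scoped Classical in
/-- The unordered edges `{i, j}` of the lattice that meet the finite set `Λ`
(see `mem_touchingEdges`). -/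
def touchingEdges (Λ : Finset (Site m)) : Finset (Sym2 (Site m)) :=
  Λ.biUnion fun i =>
    ((Finset.Icc (i - 1) (i + 1)).filter fun j => (lattice m).Adj i j).image fun j => s(i, j)

theorem mem_touchingEdges (Λ : Finset (Site m)) (e : Sym2 (Site m)) :
    e ∈ touchingEdges Λ ↔ e ∈ (lattice m).edgeSet ∧ ∃ i ∈ Λ, i ∈ e := by
  classical
  have key : ∀ i j : Site m, (lattice m).Adj i j → j ∈ Finset.Icc (i - 1) (i + 1) := by
    intro i j hij
    have hb : ∀ k, |i k - j k| ≤ 1 := fun k => by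
      have h1 : ∑ k, |i k - j k| = 1 := hij
      rw [← h1]
      exact Finset.single_le_sum (f := fun k => |i k - j k|) (fun _ _ => abs_nonneg _)
        (Finset.mem_univ k)
    rw [Finset.mem_Icc]
    constructor <;> intro k <;> have := abs_le.mp (hb k) <;> simp <;> omega
  simp only [touchingEdges, Finset.mem_biUnion, Finset.mem_image, Finset.mem_filter]
  constructor
  · rintro ⟨i, hi, j, ⟨-, hij⟩, rfl⟩
    exact ⟨hij, i, hi, Sym2.mem_mk_left i j⟩
  · rintro ⟨he, i, hi, hie⟩
    obtain ⟨j, rfl⟩ := Sym2.mem_iff_exists.mp hie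
    exact ⟨i, hi, j, ⟨key i j he, he⟩, rfl⟩

/-- The product `σ_i σ_j` along the unordered pair `{i, j}`. -/
def bond (σ : Config m) (e : Sym2 (Site m)) : ℝ :=
  Sym2.lift ⟨fun i j => spin i σ * spin j σ, fun _ _ => mul_comm _ _⟩ e

open scoped Classical in
/-- The configuration that equals `τ` on `Λ` and `η` outside. -/
def glue (Λ : Finset (Site m)) (η : Config m) (τ : Λ → ℤˣ) : Config m :=
  fun i => if hi : i ∈ Λ then τ ⟨i, hi⟩ else η i

theorem glue_injective (Λ : Finset (Site m)) (η : Config m) :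
    Function.Injective (glue Λ η) := by
  intro τ τ' hτ
  funext i
  simpa [glue] using congrFun hτ i

/-- The glued configurations are exactly those that agree with `η` outside `Λ`. -/
theorem range_glue (Λ : Finset (Site m)) (η : Config m) :
    Set.range (glue Λ η) = {σ | ∀ i, i ∉ Λ → σ i = η i} := by
  ext σ
  constructor
  · rintro ⟨τ, rfl⟩ i hi
    simp [glue, hi]
  · intro hσ
    refine ⟨fun i => σ i, ?_⟩
    funext i
    by_cases hi : i ∈ Λ
    · simp [glue, hi]
    · simp [glue, hi, hσ i hi]

/-- The partition function in `Λ` with boundary condition `η` of a Hamiltonian `H`. -/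
def partitionFunction (Λ : Finset (Site m)) (η : Config m) (H : Config m → ℝ) : ℝ :=
  ∑ τ : Λ → ℤˣ, Real.exp (-H (glue Λ η τ))

/-- The expectation of `f` under the finite-volume Gibbs measure in `Λ` with boundary
condition `η` of a Hamiltonian `H`. -/
def gibbsExpectation (Λ : Finset (Site m)) (η : Config m) (H : Config m → ℝ)
    (f : Config m → ℝ) : ℝ :=
  (∑ τ : Λ → ℤˣ, f (glue Λ η τ) * Real.exp (-H (glue Λ η τ))) / partitionFunction Λ η H

/-- The Hamiltonian of the Ising model on `ℤ^d` in `Λ`, with constant coupling `J` and field `b`. -/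
def isingHamiltonian (Λ : Finset (Site m)) (J : ℝ) (b : Site m → ℝ) (σ : Config m) : ℝ :=
  -(∑ e ∈ touchingEdges Λ, J * bond σ e) - ∑ i ∈ Λ, b i * spin i σ

open scoped Classical in
/-- The Hamiltonian of the semi-infinite Ising model in `Λ`, with constant coupling `J`, wall
parameter `lam` and field `b`: only edges inside the half-space are present. -/
def semiInfiniteHamiltonian (Λ : Finset (Site m)) (J lam : ℝ) (b : Site m → ℝ)
    (σ : Config m) : ℝ :=
  -(∑ e ∈ (touchingEdges Λ).filter (fun e => ∀ i ∈ e, i ∈ halfSpace m), J * bond σ e)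
    - (∑ i ∈ Λ, b i * spin i σ)
    - ∑ i ∈ Λ.filter (fun i => i (Fin.last m) = 1), lam * spin i σ

/-- The box `Λ_n`: `1 ≤ i_d ≤ n` and `-n ≤ i_k ≤ n` for the other coordinates. -/
def box (m n : ℕ) : Finset (Site m) :=
  Finset.Icc (fun k => if k = Fin.last m then 1 else -(n : ℤ)) (fun _ => (n : ℤ))

/-- The finite wall `[-n, n]^{d-1} × {1}`. -/
def wallBox (m n : ℕ) : Finset (Site m) :=
  Finset.Icc (fun k => if k = Fin.last m then 1 else -(n : ℤ))
    (fun k => if k = Fin.last m then 1 else (n : ℤ))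

/-- Reflection with respect to `i_d = 1/2`. -/
def reflect (i : Site m) : Site m := Function.update i (Fin.last m) (1 - i (Fin.last m))

open scoped Classical in
/-- The extended box `Δ_n`, the union of `Λ_n` and its reflection. -/
def doubleBox (m n : ℕ) : Finset (Site m) := box m n ∪ (box m n).image reflect

/-- The field on the half-space induced by the sequence `(h_ℓ)_{ℓ ≥ 1}`: it is `h_{i_d}` at `i`.
The entry `h 0` is never used at a site of the half-space. -/
def inducedField (h : ℕ → ℝ) (i : Site m) : ℝ := h (i (Fin.last m)).toNat

open scoped Classical in
/-- The extension of the induced field to `ℤ^d`: it is `h_i` on the half-space and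
`h_{-i + e_d}` off it. -/
def extendedField (h : ℕ → ℝ) (i : Site m) : ℝ :=
  if i ∈ halfSpace m then inducedField h i else inducedField h (-i + lastVec m)

/-- The wall parameter incorporated in the sequence: `lam` is added to `h_1`. -/
def addWall (lam : ℝ) (h : ℕ → ℝ) (ℓ : ℕ) : ℝ := h ℓ + if ℓ = 1 then lam else 0

/-- The constant boundary condition `ε ∈ {+1, -1}`. -/
def constConfig (m : ℕ) (ε : ℤˣ) : Config m := fun _ => ε

/-- The quantity `-(1 / (2|W_n|)) ln (Z_n² / Q_n)`, where `Z_n` is the partition function of the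
semi-infinite model in `Λ_n` and `Q_n` is that of the Ising model without field in `Δ_n`, both with
boundary condition `ε`. -/
def finiteSurfaceFreeEnergy (m : ℕ) (ε : ℤˣ) (J lam : ℝ) (h : ℕ → ℝ) (n : ℕ) : ℝ :=
  -(1 / (2 * ((wallBox m n).card : ℝ))) *
    Real.log
      (partitionFunction (box m n) (constConfig m ε)
          (semiInfiniteHamiltonian (box m n) J lam (inducedField h)) ^ 2 /
        partitionFunction (doubleBox m n) (constConfig m ε)
          (isingHamiltonian (doubleBox m n) J (fun _ => 0)))

/-- The surface free energy `F^ε(J, lam, h)` (meaningful when the limit exists). -/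
def surfaceFreeEnergy (m : ℕ) (ε : ℤˣ) (J lam : ℝ) (h : ℕ → ℝ) : ℝ :=
  limUnder atTop (finiteSurfaceFreeEnergy m ε J lam h)

/-- The perturbation `∑_{i ∈ W_n} J σ_i σ_{i - e_d} - ∑_{i ∈ Δ_n} h̄_i σ_i`, the wall parameter
being incorporated in the field. -/
def wallPerturbation (J lam : ℝ) (h : ℕ → ℝ) (n : ℕ) (σ : Config m) : ℝ :=
  (∑ i ∈ wallBox m n, J * (spin i σ * spin (i - lastVec m) σ))
    - ∑ i ∈ doubleBox m n, extendedField (addWall lam h) i * spin i σ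

/-- The state in `Δ_n` with boundary condition `ε` and Hamiltonian (the Ising Hamiltonian without
field) `+ t ·` (the perturbation above). -/
def boxState (m : ℕ) (ε : ℤˣ) (J lam : ℝ) (h : ℕ → ℝ) (n : ℕ) (t : ℝ)
    (f : Config m → ℝ) : ℝ :=
  gibbsExpectation (doubleBox m n) (constConfig m ε)
    (fun σ => isingHamiltonian (doubleBox m n) J (fun _ => 0) σ + t * wallPerturbation J lam h n σ)
    f

/-- The limiting state `⟨f⟩^ε(t)` (meaningful when the limit exists). -/
def limitState (m : ℕ) (ε : ℤˣ) (J lam : ℝ) (h : ℕ → ℝ) (t : ℝ) (f : Config m → ℝ) : ℝ :=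
  limUnder atTop fun n => boxState m ε J lam h n t f

/-- The correlation `⟨σ_{e_d} σ_0⟩^ε(t)` across the wall. -/
def wallCorrelation (m : ℕ) (ε : ℤˣ) (J lam : ℝ) (h : ℕ → ℝ) (t : ℝ) : ℝ :=
  limitState m ε J lam h t fun σ => spin (lastVec m) σ * spin 0 σ

/-- The sum of magnetizations `⟨σ_{ℓ e_d}⟩^ε(t) + ⟨σ_{-(ℓ-1) e_d}⟩^ε(t)`. -/
def layerMagnetization (m : ℕ) (ε : ℤˣ) (J lam : ℝ) (h : ℕ → ℝ) (ℓ : ℕ) (t : ℝ) : ℝ :=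
  limitState m ε J lam h t (spin ((ℓ : ℤ) • lastVec m))
    + limitState m ε J lam h t (spin (-((ℓ : ℤ) - 1) • lastVec m))

end

end SemiInfiniteIsing

open SemiInfiniteIsing

namespace SemiInfiniteIsing

noncomputable section

variable {m : ℕ}

/-! Interpolate between the two partition functions. At t = 0 the Hamiltonian is that of the Ising
model in Δ_n, with partition function Q_n. At t = 1 the bonds across the wall are switched off, the
two halves of Δ_n decouple and are mirror images, and the partition function is Z_n²
(`partitionFunction_interpolation_one`). Since the t-derivative of ln Z is minus the expected
perturbation, the finite free energy is half the integral over [0,1] of that expectation per wall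
site (`finiteSurfaceFreeEnergy_eq`). Grouped by height, the expectation becomes a combination of
averages along W_n of horizontal translates of local observables (`boxState_wallPerturbation`).

What remains is the convergence of these averages for fixed t. For t ≤ 1 the coupling (1 - t)J
across the wall is nonnegative, so the FKG inequality applies to every interpolating measure,
whatever the sign of the field. Conditioning on the spins between two volumes then makes the
ε-states of increasing functions monotone in the volume (`gibbsExpectation_volume_mono`). The
couplings and the field are invariant under translations along the wall, so the state of a translate
is the state of the original function in a translated box. Nested boxes squeeze the wall average to
the limit of the states at the origin, the sites near the rim of W_n being a vanishing fraction
(`exists_tendsto_of_monotone`). Every local function is a difference of bounded increasing ones, so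
all local observables are covered.

Spins are bounded and h is summable, so dominated convergence carries the sum over heights and the
integral over t to the limit, and also exchanges the two. -/

/-! ### Finite-volume Gibbs expectations. -/

/-- The configurations that agree with `η` outside `Λ`. -/
def configs (Λ : Finset (Site m)) (η : Config m) : Finset (Config m) :=
  Finset.univ.map ⟨glue Λ η, glue_injective Λ η⟩

theorem mem_configs {Λ : Finset (Site m)} {η σ : Config m} :
    σ ∈ configs Λ η ↔ ∀ i, i ∉ Λ → σ i = η i := by
  have hr : σ ∈ Set.range (glue Λ η) ↔ ∀ i, i ∉ Λ → σ i = η i := by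
    rw [range_glue]; rfl
  rw [← hr]
  simp [configs]

theorem sum_glue (Λ : Finset (Site m)) (η : Config m) (F : Config m → ℝ) :
    ∑ τ : Λ → ℤˣ, F (glue Λ η τ) = ∑ σ ∈ configs Λ η, F σ := by
  simp [configs]

theorem self_mem_configs (Λ : Finset (Site m)) (η : Config m) : η ∈ configs Λ η :=
  mem_configs.2 fun _ _ => rfl

theorem partitionFunction_eq (Λ : Finset (Site m)) (η : Config m) (H : Config m → ℝ) :
    partitionFunction Λ η H = ∑ σ ∈ configs Λ η, Real.exp (-H σ) :=
  sum_glue Λ η fun σ => Real.exp (-H σ)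

theorem gibbsExpectation_eq (Λ : Finset (Site m)) (η : Config m) (H f : Config m → ℝ) :
    gibbsExpectation Λ η H f =
      (∑ σ ∈ configs Λ η, f σ * Real.exp (-H σ)) / ∑ σ ∈ configs Λ η, Real.exp (-H σ) := by
  rw [gibbsExpectation, partitionFunction_eq, sum_glue Λ η fun σ => f σ * Real.exp (-H σ)]

theorem partitionFunction_pos (Λ : Finset (Site m)) (η : Config m) (H : Config m → ℝ) :
    0 < partitionFunction Λ η H := by
  rw [partitionFunction_eq]
  exact Finset.sum_pos (fun _ _ => Real.exp_pos _) ⟨η, self_mem_configs Λ η⟩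

theorem gibbsExpectation_congr {Λ : Finset (Site m)} {η : Config m} {H H' f f' : Config m → ℝ}
    (hH : ∀ σ ∈ configs Λ η, H σ = H' σ) (hf : ∀ σ ∈ configs Λ η, f σ = f' σ) :
    gibbsExpectation Λ η H f = gibbsExpectation Λ η H' f' := by
  rw [gibbsExpectation_eq, gibbsExpectation_eq]
  congr 1 <;> refine Finset.sum_congr rfl fun σ hσ => ?_ <;> simp only [hH σ hσ]
  rw [hf σ hσ]

theorem gibbsExpectation_add (Λ : Finset (Site m)) (η : Config m) (H f g : Config m → ℝ) :
    gibbsExpectation Λ η H (fun σ => f σ + g σ) =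
      gibbsExpectation Λ η H f + gibbsExpectation Λ η H g := by
  simp only [gibbsExpectation, add_mul, Finset.sum_add_distrib, add_div]

theorem gibbsExpectation_const_mul (Λ : Finset (Site m)) (η : Config m) (H f : Config m → ℝ)
    (c : ℝ) :
    gibbsExpectation Λ η H (fun σ => c * f σ) = c * gibbsExpectation Λ η H f := by
  simp only [gibbsExpectation, mul_assoc, ← Finset.mul_sum, mul_div_assoc]

theorem gibbsExpectation_sub (Λ : Finset (Site m)) (η : Config m) (H f g : Config m → ℝ) :
    gibbsExpectation Λ η H (fun σ => f σ - g σ) =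
      gibbsExpectation Λ η H f - gibbsExpectation Λ η H g := by
  simp only [gibbsExpectation, sub_mul, Finset.sum_sub_distrib, sub_div]

theorem gibbsExpectation_sum {ι : Type*} (s : Finset ι) (Λ : Finset (Site m)) (η : Config m)
    (H : Config m → ℝ) (f : ι → Config m → ℝ) :
    gibbsExpectation Λ η H (fun σ => ∑ a ∈ s, f a σ) =
      ∑ a ∈ s, gibbsExpectation Λ η H (f a) := by
  simp only [gibbsExpectation, Finset.sum_mul, ← Finset.sum_div]
  rw [Finset.sum_comm]

theorem abs_gibbsExpectation_le (Λ : Finset (Site m)) (η : Config m) (H : Config m → ℝ)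
    {f : Config m → ℝ} {C : ℝ} (hf : ∀ σ, |f σ| ≤ C) : |gibbsExpectation Λ η H f| ≤ C := by
  rw [gibbsExpectation, abs_div, abs_of_pos (partitionFunction_pos Λ η H),
    div_le_iff₀ (partitionFunction_pos Λ η H), partitionFunction, Finset.mul_sum]
  refine (Finset.abs_sum_le_sum_abs _ _).trans (Finset.sum_le_sum fun τ _ => ?_)
  rw [abs_mul, abs_of_pos (Real.exp_pos _)]
  exact mul_le_mul_of_nonneg_right (hf _) (Real.exp_pos _).le

theorem abs_spin (i : Site m) (σ : Config m) : |spin i σ| = 1 := by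
  rcases Int.units_eq_one_or (σ i) with h | h <;> simp [spin, h]

theorem abs_spin_mul_spin (i j : Site m) (σ : Config m) : |spin i σ * spin j σ| = 1 := by
  rw [abs_mul, abs_spin, abs_spin, one_mul]

theorem spin_monotone (i : Site m) : Monotone (spin i) := fun σ σ' h => by
  have h1 : (σ i : ℤ) ≤ (σ' i : ℤ) := h i
  simpa [spin] using h1

/-! ### Submodular Hamiltonians, FKG, and monotonicity in the volume. -/

/-- The Hamiltonian in `Λ` with couplings `K` on the edges and field `b` at the sites. -/
def pairHamiltonian (Λ : Finset (Site m)) (K : Sym2 (Site m) → ℝ) (b : Site m → ℝ)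
    (σ : Config m) : ℝ :=
  -(∑ e ∈ touchingEdges Λ, K e * bond σ e) - ∑ i ∈ Λ, b i * spin i σ

theorem bond_congr {σ η : Config m} {e : Sym2 (Site m)} (h : ∀ i ∈ e, σ i = η i) :
    bond σ e = bond η e := by
  induction e using Sym2.ind with
  | _ i j =>
    simp only [bond, Sym2.lift_mk, spin]
    rw [h i (Sym2.mem_mk_left i j), h j (Sym2.mem_mk_right i j)]

theorem bond_inf_sup (σ σ' : Config m) (e : Sym2 (Site m)) :
    bond σ e + bond σ' e ≤ bond (σ ⊓ σ') e + bond (σ ⊔ σ') e := by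
  have key : ∀ a b c d : ℤˣ, (a * b + c * d : ℤ) ≤
      (a ⊓ c : ℤˣ) * (b ⊓ d : ℤˣ) + (a ⊔ c : ℤˣ) * (b ⊔ d : ℤˣ) := by decide
  induction e using Sym2.ind with
  | _ i j =>
    simp only [bond, Sym2.lift_mk, spin, Pi.inf_apply, Pi.sup_apply]
    exact_mod_cast key (σ i) (σ j) (σ' i) (σ' j)

theorem spin_inf_sup (i : Site m) (σ σ' : Config m) :
    spin i σ + spin i σ' = spin i (σ ⊓ σ') + spin i (σ ⊔ σ') := by
  have key : ∀ a b : ℤˣ, (a + b : ℤ) = (a ⊓ b : ℤˣ) + (a ⊔ b : ℤˣ) := by decide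
  simp only [spin, Pi.inf_apply, Pi.sup_apply]
  exact_mod_cast key (σ i) (σ' i)

/-- This is the FKG lattice condition for the weight exp(-H). Each bond is supermodular and enters
with a nonnegative coupling; single spins are modular, so the field may have any sign. -/
theorem pairHamiltonian_inf_sup (Λ : Finset (Site m)) {K : Sym2 (Site m) → ℝ} (hK : ∀ e, 0 ≤ K e)
    (b : Site m → ℝ) (σ σ' : Config m) :
    pairHamiltonian Λ K b (σ ⊓ σ') + pairHamiltonian Λ K b (σ ⊔ σ') ≤
      pairHamiltonian Λ K b σ + pairHamiltonian Λ K b σ' := by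
  have h1 : ∑ e ∈ touchingEdges Λ, K e * bond σ e + ∑ e ∈ touchingEdges Λ, K e * bond σ' e ≤
      ∑ e ∈ touchingEdges Λ, K e * bond (σ ⊓ σ') e
        + ∑ e ∈ touchingEdges Λ, K e * bond (σ ⊔ σ') e := by
    rw [← Finset.sum_add_distrib, ← Finset.sum_add_distrib]
    refine Finset.sum_le_sum fun e _ => ?_
    rw [← mul_add, ← mul_add]
    exact mul_le_mul_of_nonneg_left (bond_inf_sup σ σ' e) (hK e)
  have h2 : ∑ i ∈ Λ, b i * spin i σ + ∑ i ∈ Λ, b i * spin i σ' =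
      ∑ i ∈ Λ, b i * spin i (σ ⊓ σ') + ∑ i ∈ Λ, b i * spin i (σ ⊔ σ') := by
    rw [← Finset.sum_add_distrib, ← Finset.sum_add_distrib]
    refine Finset.sum_congr rfl fun i _ => ?_
    rw [← mul_add, ← mul_add, spin_inf_sup]
  simp only [pairHamiltonian]
  linarith

theorem touchingEdges_mono {Λ Λ' : Finset (Site m)} (h : Λ ⊆ Λ') :
    touchingEdges Λ ⊆ touchingEdges Λ' := fun e he => by
  rw [mem_touchingEdges] at he ⊢
  obtain ⟨h1, i, hi, hie⟩ := he
  exact ⟨h1, i, h hi, hie⟩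

/-- Off the smaller volume, the Hamiltonian of the larger volume is constant. -/
theorem pairHamiltonian_of_mem_configs {Λ Λ' : Finset (Site m)} (h : Λ ⊆ Λ')
    (K : Sym2 (Site m) → ℝ) (b : Site m → ℝ) {η σ : Config m} (hσ : σ ∈ configs Λ η) :
    pairHamiltonian Λ' K b σ = pairHamiltonian Λ K b σ
      + (pairHamiltonian Λ' K b η - pairHamiltonian Λ K b η) := by
  classical
  rw [mem_configs] at hσ
  have h1 : ∑ e ∈ touchingEdges Λ' \ touchingEdges Λ, K e * bond σ e =
      ∑ e ∈ touchingEdges Λ' \ touchingEdges Λ, K e * bond η e := by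
    refine Finset.sum_congr rfl fun e he => ?_
    rw [Finset.mem_sdiff, mem_touchingEdges, mem_touchingEdges] at he
    rw [bond_congr fun i hi => hσ i fun hiΛ => he.2 ⟨he.1.1, i, hiΛ, hi⟩]
  have h2 : ∑ i ∈ Λ' \ Λ, b i * spin i σ = ∑ i ∈ Λ' \ Λ, b i * spin i η := by
    refine Finset.sum_congr rfl fun i hi => ?_
    rw [spin, hσ i (Finset.mem_sdiff.1 hi).2, spin]
  simp only [pairHamiltonian, ← Finset.sum_sdiff h, ← Finset.sum_sdiff (touchingEdges_mono h),
    h1, h2]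
  ring

/-- The FKG inequality, without a sign condition on the functions. -/
theorem fkg_of_monotone {α : Type*} [DistribLattice α] [Fintype α] (f g μ : α → ℝ) (hμ : 0 ≤ μ)
    (hf : Monotone f) (hg : Monotone g)
    (hlat : ∀ a b, μ a * μ b ≤ μ (a ⊓ b) * μ (a ⊔ b)) :
    (∑ a, μ a * f a) * ∑ a, μ a * g a ≤ (∑ a, μ a) * ∑ a, μ a * (f a * g a) := by
  have bd : ∀ f : α → ℝ, ∃ c : ℝ, ∀ a, 0 ≤ f a + c := fun f =>
    ⟨∑ a, |f a|, fun a => by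
      have := Finset.single_le_sum (f := fun a => |f a|) (fun _ _ => abs_nonneg _)
        (Finset.mem_univ a)
      linarith [neg_abs_le (f a)]⟩
  obtain ⟨c, hc⟩ := bd f
  obtain ⟨d, hd⟩ := bd g
  -- `fkg` concerns nonnegative functions; a covariance does not change when constants are added.
  have h := fkg (fun a => f a + c) (fun a => g a + d) μ hμ hc hd
    (fun x y hxy => add_le_add_left (hf hxy) c) (fun x y hxy => add_le_add_left (hg hxy) d) hlat
  have e1 : ∑ a, μ a * (f a + c) = ∑ a, μ a * f a + c * ∑ a, μ a := by
    rw [Finset.mul_sum, ← Finset.sum_add_distrib]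
    exact Finset.sum_congr rfl fun _ _ => by ring
  have e2 : ∑ a, μ a * (g a + d) = ∑ a, μ a * g a + d * ∑ a, μ a := by
    rw [Finset.mul_sum, ← Finset.sum_add_distrib]
    exact Finset.sum_congr rfl fun _ _ => by ring
  have e3 : ∑ a, μ a * ((f a + c) * (g a + d)) = ∑ a, μ a * (f a * g a) + d * ∑ a, μ a * f a
      + c * ∑ a, μ a * g a + c * d * ∑ a, μ a := by
    simp only [Finset.mul_sum, ← Finset.sum_add_distrib]
    exact Finset.sum_congr rfl fun _ _ => by ring
  rw [e1, e2, e3] at h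
  nlinarith [h]

theorem glue_inf (Λ : Finset (Site m)) (η : Config m) (τ τ' : Λ → ℤˣ) :
    glue Λ η (τ ⊓ τ') = glue Λ η τ ⊓ glue Λ η τ' := by
  funext i
  by_cases hi : i ∈ Λ <;> simp [glue, hi]

theorem glue_sup (Λ : Finset (Site m)) (η : Config m) (τ τ' : Λ → ℤˣ) :
    glue Λ η (τ ⊔ τ') = glue Λ η τ ⊔ glue Λ η τ' := by
  funext i
  by_cases hi : i ∈ Λ <;> simp [glue, hi]

theorem glue_monotone (Λ : Finset (Site m)) (η : Config m) : Monotone (glue Λ η) := by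
  intro τ τ' h i
  by_cases hi : i ∈ Λ
  · simpa [glue, hi] using h ⟨i, hi⟩
  · simp [glue, hi]

/-- The FKG inequality for the ferromagnetic Gibbs measures. -/
theorem sum_configs_fkg (Λ : Finset (Site m)) (η : Config m) {K : Sym2 (Site m) → ℝ}
    (hK : ∀ e, 0 ≤ K e) (b : Site m → ℝ) {f g : Config m → ℝ} (hf : Monotone f)
    (hg : Monotone g) :
    (∑ σ ∈ configs Λ η, Real.exp (-pairHamiltonian Λ K b σ) * f σ) *
        ∑ σ ∈ configs Λ η, Real.exp (-pairHamiltonian Λ K b σ) * g σ ≤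
      (∑ σ ∈ configs Λ η, Real.exp (-pairHamiltonian Λ K b σ)) *
        ∑ σ ∈ configs Λ η, Real.exp (-pairHamiltonian Λ K b σ) * (f σ * g σ) := by
  simp only [← sum_glue]
  refine fkg_of_monotone (fun τ => f (glue Λ η τ)) (fun τ => g (glue Λ η τ))
    (fun τ => Real.exp (-pairHamiltonian Λ K b (glue Λ η τ))) (fun _ => (Real.exp_pos _).le)
    (hf.comp (glue_monotone Λ η)) (hg.comp (glue_monotone Λ η)) fun τ τ' => ?_
  rw [← Real.exp_add, ← Real.exp_add, glue_inf, glue_sup, Real.exp_le_exp]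
  linarith [pairHamiltonian_inf_sup Λ hK b (glue Λ η τ) (glue Λ η τ')]

/-- Monotonicity in the volume: the `+` states decrease and the `-` states increase. -/
theorem gibbsExpectation_volume_mono {Λ Λ' : Finset (Site m)} (h : Λ ⊆ Λ') (ε : ℤˣ)
    {K : Sym2 (Site m) → ℝ} (hK : ∀ e, 0 ≤ K e) (b : Site m → ℝ) {f : Config m → ℝ}
    (hf : Monotone f) :
    (ε : ℤ) * gibbsExpectation Λ' (constConfig m ε) (pairHamiltonian Λ' K b) f ≤
      (ε : ℤ) * gibbsExpectation Λ (constConfig m ε) (pairHamiltonian Λ K b) f := by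
  classical
  set η := constConfig m ε with hη
  have hsub : (configs Λ' η).filter (fun σ => σ ∈ configs Λ η) = configs Λ η := by
    ext σ
    simp only [Finset.mem_filter, mem_configs, and_iff_right_iff_imp]
    exact fun hσ i hi => hσ i fun hi' => hi (h hi')
  -- The event that all spins in the shell Λ' \ Λ equal ε is increasing for ε = +1 and decreasing
  -- for ε = -1; the factor ε makes `g` increasing in both cases. Conditioning the Λ'-state on this
  -- event gives the Λ-state, and FKG for `f` and `g` compares the two.
  let g : Config m → ℝ := fun σ => (ε : ℤ) * if ∀ i ∈ Λ', i ∉ Λ → σ i = ε then 1 else 0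
  have hg : Monotone g := by
    intro σ σ' hle
    have key : ∀ a b : ℤˣ, a ≤ b → (a = 1 → b = 1) ∧ (b = -1 → a = -1) := by decide
    simp only [g]
    rcases Int.units_eq_one_or ε with rfl | rfl
    · by_cases h1 : ∀ i ∈ Λ', i ∉ Λ → σ i = 1
      · have h2 : ∀ i ∈ Λ', i ∉ Λ → σ' i = 1 := fun i hi hi' => (key _ _ (hle i)).1 (h1 i hi hi')
        simp [if_pos h1, if_pos h2]
      · simp only [if_neg h1]
        split_ifs <;> simp
    · by_cases h1 : ∀ i ∈ Λ', i ∉ Λ → σ' i = -1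
      · have h2 : ∀ i ∈ Λ', i ∉ Λ → σ i = -1 := fun i hi hi' => (key _ _ (hle i)).2 (h1 i hi hi')
        simp [if_pos h1, if_pos h2]
      · simp only [if_neg h1]
        split_ifs <;> simp
  have hgval : ∀ σ ∈ configs Λ' η, g σ = (ε : ℤ) * if σ ∈ configs Λ η then 1 else 0 := by
    intro σ hσ
    have : (∀ i ∈ Λ', i ∉ Λ → σ i = ε) ↔ σ ∈ configs Λ η := by
      rw [mem_configs] at hσ ⊢
      constructor
      · intro h1 i hi
        by_cases hi' : i ∈ Λ'
        · exact h1 i hi' hi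
        · exact hσ i hi'
      · exact fun h1 i _ hi => h1 i hi
    simp only [g, this]
  -- On the conditioned configurations the two Boltzmann weights differ by this constant factor,
  -- which cancels at the end.
  set c := Real.exp (-(pairHamiltonian Λ' K b η - pairHamiltonian Λ K b η)) with hc
  have hcpos : 0 < c := Real.exp_pos _
  have hsum : ∀ F : Config m → ℝ,
      ∑ σ ∈ configs Λ' η, Real.exp (-pairHamiltonian Λ' K b σ) * (F σ * g σ) =
        (ε : ℤ) * c * ∑ σ ∈ configs Λ η, F σ * Real.exp (-pairHamiltonian Λ K b σ) := by
    intro F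
    rw [Finset.mul_sum, ← hsub, Finset.sum_filter]
    refine Finset.sum_congr rfl fun σ hσ => ?_
    rw [hgval σ hσ]
    split_ifs with h1
    · rw [pairHamiltonian_of_mem_configs h K b h1, neg_add, Real.exp_add, ← hc]
      ring
    · simp
  have hF := sum_configs_fkg Λ' η hK b hf hg
  have hone := hsum fun _ => 1
  simp only [one_mul] at hone
  rw [hsum, hone] at hF
  have hZ := partitionFunction_pos Λ η (pairHamiltonian Λ K b)
  have hZ' := partitionFunction_pos Λ' η (pairHamiltonian Λ' K b)
  rw [partitionFunction_eq] at hZ hZ'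
  rw [gibbsExpectation_eq, gibbsExpectation_eq, ← mul_div_assoc, ← mul_div_assoc,
    div_le_div_iff₀ hZ' hZ]
  simp only [mul_comm (Real.exp _) (f _)] at hF
  refine le_of_mul_le_mul_left ?_ hcpos
  linarith

/-! ### Local functions as differences of increasing functions. -/

/-- A function of finitely many spins is bounded. -/
theorem exists_abs_le_of_dependsOn {f : Config m → ℝ} {A : Finset (Site m)}
    (hf : DependsOn f (A : Set (Site m))) : ∃ C, ∀ σ, |f σ| ≤ C := by
  refine ⟨∑ τ : A → ℤˣ, |f (glue A 1 τ)|, fun σ => ?_⟩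
  have h1 : f σ = f (glue A 1 fun i => σ i) := hf fun i hi => by
    have : i ∈ A := hi
    simp [glue, this]
  rw [h1]
  exact Finset.single_le_sum (f := fun τ : A → ℤˣ => |f (glue A 1 τ)|) (fun _ _ => abs_nonneg _)
    (Finset.mem_univ _)

/-- A function of finitely many spins is the difference of two bounded monotone functions. -/
theorem exists_monotone_sub {f : Config m → ℝ} {A : Finset (Site m)}
    (hf : DependsOn f (A : Set (Site m))) :
    ∃ g k : Config m → ℝ, Monotone g ∧ Monotone k ∧ (∃ C, ∀ σ, |g σ| ≤ C) ∧
      (∃ C, ∀ σ, |k σ| ≤ C) ∧ f = fun σ => g σ - k σ := by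
  obtain ⟨C, hC⟩ := exists_abs_le_of_dependsOn hf
  have hC0 : 0 ≤ C := (abs_nonneg _).trans (hC 1)
  have hk : ∀ σ : Config m, |C * ∑ i ∈ A, spin i σ| ≤ C * A.card := fun σ => by
    rw [abs_mul, abs_of_nonneg hC0]
    refine mul_le_mul_of_nonneg_left ((Finset.abs_sum_le_sum_abs _ _).trans ?_) hC0
    simp [abs_spin]
  -- Raising a spin of `A` increases the sum of spins by at least 2, hence the added term by at
  -- least 2C, which absorbs the oscillation of `f`.
  refine ⟨fun σ => f σ + C * ∑ i ∈ A, spin i σ, fun σ => C * ∑ i ∈ A, spin i σ, ?_, ?_,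
    ⟨C + C * A.card, fun σ => (abs_add_le _ _).trans (add_le_add (hC σ) (hk σ))⟩, ⟨_, hk⟩,
    by simp⟩
  · intro σ σ' hle
    by_cases heq : ∀ i ∈ A, σ i = σ' i
    · have h1 : f σ = f σ' := hf fun i hi => heq i hi
      have h2 : ∑ i ∈ A, spin i σ = ∑ i ∈ A, spin i σ' :=
        Finset.sum_congr rfl fun i hi => by simp [spin, heq i hi]
      simp [h1, h2]
    · push Not at heq
      obtain ⟨i, hi, hne⟩ := heq
      have h1 : spin i σ + 2 ≤ spin i σ' := by
        have key : ∀ a b : ℤˣ, a ≤ b → a ≠ b → (a : ℤ) + 2 ≤ b := by decide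
        have := key _ _ (hle i) hne
        simp only [spin]
        exact_mod_cast this
      have h2 : ∑ i ∈ A, spin i σ + 2 ≤ ∑ i ∈ A, spin i σ' := by
        classical
        rw [← Finset.add_sum_erase A _ hi, ← Finset.add_sum_erase A _ hi]
        have := Finset.sum_le_sum fun j (_ : j ∈ A.erase i) => spin_monotone j hle
        linarith
      have := mul_le_mul_of_nonneg_left h2 hC0
      have h3 := abs_le.1 (hC σ)
      have h4 := abs_le.1 (hC σ')
      simp only
      linarith
  · exact fun σ σ' hle => mul_le_mul_of_nonneg_left
      (Finset.sum_le_sum fun i _ => spin_monotone i hle) hC0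

/-! ### Translations. -/

/-- The configuration translated by `v`. -/
def shift (v : Site m) (σ : Config m) : Config m := fun i => σ (i + v)

theorem spin_shift (v i : Site m) (σ : Config m) : spin i (shift v σ) = spin (i + v) σ := rfl

theorem bond_shift (v : Site m) (σ : Config m) (e : Sym2 (Site m)) :
    bond (shift v σ) e = bond σ (e.map (· + v)) := by
  induction e using Sym2.ind with
  | _ i j => rfl

theorem sum_touchingEdges_translate (Λ : Finset (Site m)) (v : Site m)
    (F : Sym2 (Site m) → ℝ) :
    ∑ e ∈ touchingEdges (Λ.map (Equiv.addRight (-v)).toEmbedding), F (e.map (· + v)) =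
      ∑ e ∈ touchingEdges Λ, F e := by
  refine Finset.sum_bij' (fun e _ => e.map (· + v)) (fun e _ => e.map (· + -v)) ?_ ?_ ?_ ?_ ?_
  · intro e he
    induction e using Sym2.ind with
    | _ i j =>
      simp only [mem_touchingEdges, Sym2.map_mk, SimpleGraph.mem_edgeSet, Sym2.mem_iff,
        lattice] at he ⊢
      obtain ⟨h1, k, hk, hkij⟩ := he
      refine ⟨by simpa using h1, k + v, ?_, by simpa using hkij⟩
      simp only [Finset.mem_map_equiv, Equiv.addRight_symm, Equiv.coe_addRight, neg_neg] at hk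
      exact hk
  · intro e he
    induction e using Sym2.ind with
    | _ i j =>
      simp only [mem_touchingEdges, Sym2.map_mk, SimpleGraph.mem_edgeSet, Sym2.mem_iff,
        lattice] at he ⊢
      obtain ⟨h1, k, hk, hkij⟩ := he
      refine ⟨by simpa using h1, k + -v, ?_, by simpa using hkij⟩
      simpa using hk
  · intro e _
    induction e using Sym2.ind with
    | _ i j => simp
  · intro e _
    induction e using Sym2.ind with
    | _ i j => simp
  · intro e _
    rfl

/-- Translating every configuration is an energy-preserving bijection, because the couplings and the
field are invariant under `v` and the boundary condition is constant. Thus moving the observable by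
`v` amounts to moving the volume by `-v`. -/
theorem gibbsExpectation_shift (Λ : Finset (Site m)) (v : Site m) (ε : ℤˣ)
    {K : Sym2 (Site m) → ℝ} (hK : ∀ e, K (e.map (· + v)) = K e) {b : Site m → ℝ}
    (hb : ∀ i, b (i + v) = b i) (f : Config m → ℝ) :
    gibbsExpectation Λ (constConfig m ε) (pairHamiltonian Λ K b) (fun σ => f (shift v σ)) =
      gibbsExpectation (Λ.map (Equiv.addRight (-v)).toEmbedding) (constConfig m ε)
        (pairHamiltonian (Λ.map (Equiv.addRight (-v)).toEmbedding) K b) f := by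
  set Λ' := Λ.map (Equiv.addRight (-v)).toEmbedding with hΛ'
  have hH : ∀ σ : Config m, pairHamiltonian Λ' K b (shift v σ) = pairHamiltonian Λ K b σ := by
    intro σ
    simp only [pairHamiltonian]
    rw [← sum_touchingEdges_translate Λ v fun e => K e * bond σ e]
    simp only [hK, bond_shift, hΛ', Finset.sum_map, Equiv.coe_toEmbedding, Equiv.coe_addRight,
      spin_shift, neg_add_cancel_right]
    congr 1
    refine Finset.sum_congr rfl fun i _ => ?_
    rw [← hb (i + -v), neg_add_cancel_right]
  have key : ∀ F : Config m → ℝ, ∑ σ ∈ configs Λ (constConfig m ε), F (shift v σ) =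
      ∑ σ ∈ configs Λ' (constConfig m ε), F σ := by
    intro F
    refine Finset.sum_bij' (fun σ _ => shift v σ) (fun σ _ => shift (-v) σ) ?_ ?_ ?_ ?_ ?_
    · intro σ hσ
      rw [mem_configs] at hσ ⊢
      intro i hi
      refine hσ (i + v) fun h => hi ?_
      simpa [hΛ', Finset.mem_map_equiv] using h
    · intro σ hσ
      rw [mem_configs] at hσ ⊢
      intro i hi
      refine hσ (i + -v) fun h => hi ?_
      simpa [hΛ', Finset.mem_map_equiv] using h
    · intro σ _
      funext i
      simp [shift]
    · intro σ _
      funext i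
      simp [shift]
    · intro σ _
      rfl
  rw [gibbsExpectation_eq, gibbsExpectation_eq, ← key, ← key]
  simp only [hH]

/-! ### Geometry of the boxes and of the edges across the wall. -/

theorem lastVec_last : lastVec m (Fin.last m) = 1 := by simp [lastVec]

theorem lastVec_castSucc (k : Fin m) : lastVec m k.castSucc = 0 := by
  simp [lastVec, Fin.castSucc_ne_last]

theorem site_ext {i j : Site m} (h1 : ∀ k : Fin m, i k.castSucc = j k.castSucc)
    (h2 : i (Fin.last m) = j (Fin.last m)) : i = j := by
  funext k
  induction k using Fin.lastCases with
  | last => exact h2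
  | cast k => exact h1 k

theorem mem_box {n : ℕ} {i : Site m} : i ∈ box m n ↔
    (∀ k : Fin m, -(n : ℤ) ≤ i k.castSucc ∧ i k.castSucc ≤ n) ∧
      1 ≤ i (Fin.last m) ∧ i (Fin.last m) ≤ n := by
  simp only [box, Finset.mem_Icc, Pi.le_def, Fin.forall_fin_succ', if_pos,
    Fin.castSucc_ne_last, if_false, forall_and]
  tauto

theorem mem_wallBox {n : ℕ} {i : Site m} : i ∈ wallBox m n ↔
    (∀ k : Fin m, -(n : ℤ) ≤ i k.castSucc ∧ i k.castSucc ≤ n) ∧ i (Fin.last m) = 1 := by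
  simp only [wallBox, Finset.mem_Icc, Pi.le_def, Fin.forall_fin_succ', if_pos,
    Fin.castSucc_ne_last, if_false, forall_and]
  constructor
  · rintro ⟨⟨h1, h2⟩, h3, h4⟩
    exact ⟨⟨h1, h3⟩, le_antisymm h4 h2⟩
  · rintro ⟨⟨h1, h2⟩, h3⟩
    exact ⟨⟨h1, h3.ge⟩, h2, h3.le⟩

theorem reflect_last (i : Site m) : reflect i (Fin.last m) = 1 - i (Fin.last m) := by
  simp [reflect]

theorem reflect_castSucc (i : Site m) (k : Fin m) : reflect i k.castSucc = i k.castSucc := by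
  simp [reflect, Fin.castSucc_ne_last]

theorem reflect_reflect (i : Site m) : reflect (reflect i) = i :=
  site_ext (fun k => by simp [reflect_castSucc]) (by simp [reflect_last])

theorem mem_doubleBox {n : ℕ} {i : Site m} : i ∈ doubleBox m n ↔
    (∀ k : Fin m, -(n : ℤ) ≤ i k.castSucc ∧ i k.castSucc ≤ n) ∧
      1 - (n : ℤ) ≤ i (Fin.last m) ∧ i (Fin.last m) ≤ n := by
  classical
  have h : (∃ j ∈ box m n, reflect j = i) ↔ reflect i ∈ box m n := by
    constructor
    · rintro ⟨j, hj, rfl⟩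
      rwa [reflect_reflect]
    · exact fun hi => ⟨_, hi, reflect_reflect i⟩
  simp only [doubleBox, Finset.mem_union, Finset.mem_image, h]
  simp only [mem_box, reflect_castSucc, reflect_last]
  constructor
  · rintro (⟨h1, h2, h3⟩ | ⟨h1, h2, h3⟩) <;> exact ⟨h1, by omega, by omega⟩
  · rintro ⟨h1, h2, h3⟩
    by_cases h4 : 1 ≤ i (Fin.last m)
    · exact Or.inl ⟨h1, h4, h3⟩
    · exact Or.inr ⟨h1, by omega, by omega⟩

theorem card_wallBox (n : ℕ) : (wallBox m n).card = (2 * n + 1) ^ m := by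
  rw [wallBox, Pi.card_Icc, Fin.prod_univ_castSucc]
  simp only [Fin.castSucc_ne_last, if_false, if_true, Int.card_Icc, Finset.prod_const,
    Finset.card_univ, Fintype.card_fin]
  rw [show ((n : ℤ) + 1 - -(n : ℤ)).toNat = 2 * n + 1 by omega]
  simp

theorem lattice_adj_sub_lastVec (i : Site m) : (lattice m).Adj i (i - lastVec m) := by
  change ∑ k, |i k - (i - lastVec m) k| = 1
  rw [Fin.sum_univ_castSucc]
  simp [lastVec_castSucc, lastVec_last]

theorem mem_halfSpace {i : Site m} : i ∈ halfSpace m ↔ 1 ≤ i (Fin.last m) := Iff.rfl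

/-- The only edges leaving the half-space are the vertical ones across the wall. -/
theorem eq_sub_lastVec_of_adj {i j : Site m} (h : (lattice m).Adj i j) (hi : i ∈ halfSpace m)
    (hj : j ∉ halfSpace m) : i (Fin.last m) = 1 ∧ j = i - lastVec m := by
  have h1 : ∑ k, |i k - j k| = 1 := h
  rw [mem_halfSpace] at hi hj
  rw [Fin.sum_univ_castSucc] at h1
  have h2 : 0 ≤ ∑ k : Fin m, |i k.castSucc - j k.castSucc| :=
    Finset.sum_nonneg fun _ _ => abs_nonneg _
  have h3 : |i (Fin.last m) - j (Fin.last m)| = i (Fin.last m) - j (Fin.last m) :=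
    abs_of_nonneg (by omega)
  have h4 : ∑ k : Fin m, |i k.castSucc - j k.castSucc| = 0 := by omega
  rw [Finset.sum_eq_zero_iff_of_nonneg fun _ _ => abs_nonneg _] at h4
  refine ⟨by omega, site_ext (fun k => ?_) ?_⟩
  · have := abs_eq_zero.1 (h4 k (Finset.mem_univ k))
    rw [Pi.sub_apply, lastVec_castSucc]
    omega
  · rw [Pi.sub_apply, lastVec_last]
    omega

/-- The edges that do not cross the wall. -/
def OneSided (e : Sym2 (Site m)) : Prop := (∀ i ∈ e, i ∈ halfSpace m) ∨ ∀ i ∈ e, i ∉ halfSpace m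

-- An edge with one end in each half-space is vertical, with its upper end at height 1, so it is
-- determined by that end. The case n = 0 is excluded because Δ_0 is empty while W_0 is not.
open scoped Classical in
theorem sum_crossing_edges {n : ℕ} (hn : 1 ≤ n) (F : Sym2 (Site m) → ℝ) :
    ∑ e ∈ (touchingEdges (doubleBox m n)).filter (fun e => ¬ OneSided e), F e =
      ∑ i ∈ wallBox m n, F s(i, i - lastVec m) := by
  have hcast : ∀ (i : Site m) (k : Fin m), (i - lastVec m) k.castSucc = i k.castSucc := fun i k => by
    rw [Pi.sub_apply, lastVec_castSucc, sub_zero]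
  have hlast : ∀ i : Site m, (i - lastVec m) (Fin.last m) = i (Fin.last m) - 1 := fun i => by
    rw [Pi.sub_apply, lastVec_last]
  symm
  refine Finset.sum_bij (fun i _ => s(i, i - lastVec m)) ?_ ?_ ?_ fun _ _ => rfl
  · intro i hi
    rw [mem_wallBox] at hi
    rw [Finset.mem_filter, mem_touchingEdges]
    refine ⟨⟨lattice_adj_sub_lastVec i, i, mem_doubleBox.2 ⟨hi.1, by omega, by omega⟩,
      Sym2.mem_mk_left _ _⟩, ?_⟩
    rintro (h | h)
    · have := h _ (Sym2.mem_mk_right _ _)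
      rw [mem_halfSpace, hlast] at this
      omega
    · exact h _ (Sym2.mem_mk_left _ _) (mem_halfSpace.2 hi.2.ge)
  · intro i hi j hj hij
    rcases Sym2.eq_iff.1 hij with h | h
    · exact h.1
    · have := congrFun h.1 (Fin.last m)
      rw [hlast, (mem_wallBox.1 hi).2, (mem_wallBox.1 hj).2] at this
      omega
  · intro e he
    rw [Finset.mem_filter, mem_touchingEdges] at he
    obtain ⟨⟨hadj, k, hk, hke⟩, hcross⟩ := he
    have key : ∀ i j : Site m, e = s(i, j) → i ∈ halfSpace m → j ∉ halfSpace m →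
        ∃ a, ∃ _ : a ∈ wallBox m n, s(a, a - lastVec m) = e := by
      rintro i j rfl hi hj
      obtain ⟨h1, hj'⟩ := eq_sub_lastVec_of_adj (i := i) (j := j) hadj hi hj
      subst hj'
      refine ⟨i, mem_wallBox.2 ⟨fun l => ?_, h1⟩, rfl⟩
      rcases Sym2.mem_iff.1 hke with rfl | rfl
      · exact (mem_doubleBox.1 hk).1 l
      · rw [← hcast i l]
        exact (mem_doubleBox.1 hk).1 l
    induction e using Sym2.ind with
    | _ i j =>
      simp only [OneSided, Sym2.mem_iff, forall_eq_or_imp, forall_eq] at hcross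
      by_cases hi : i ∈ halfSpace m
      · exact key i j rfl hi fun hj => hcross (Or.inl ⟨hi, hj⟩)
      · exact key j i Sym2.eq_swap (by by_contra hj; exact hcross (Or.inr ⟨hi, hj⟩)) hi

/-! ### The interpolating ferromagnet and its invariance along the wall. -/

open scoped Classical in
/-- The interpolating couplings: those of the edges across the wall are multiplied by `1 - t`. -/
def wallCoupling (m : ℕ) (J t : ℝ) (e : Sym2 (Site m)) : ℝ := if OneSided e then J else (1 - t) * J

theorem wallCoupling_nonneg {J t : ℝ} (hJ : 0 ≤ J) (ht : t ≤ 1) (e : Sym2 (Site m)) :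
    0 ≤ wallCoupling m J t e := by
  unfold wallCoupling
  split_ifs
  · exact hJ
  · exact mul_nonneg (by linarith) hJ

/-- The wall term of the perturbation merely weakens the crossing bonds from J to (1 - t)J. In this
form the interpolation falls under the FKG results as long as t ≤ 1. -/
theorem interpolation_eq_pairHamiltonian {n : ℕ} (hn : 1 ≤ n) (J lam : ℝ) (h : ℕ → ℝ) (t : ℝ)
    (σ : Config m) :
    isingHamiltonian (doubleBox m n) J (fun _ => 0) σ + t * wallPerturbation J lam h n σ =
      pairHamiltonian (doubleBox m n) (wallCoupling m J t)
        (fun i => t * extendedField (addWall lam h) i) σ := by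
  classical
  have h1 : ∑ e ∈ touchingEdges (doubleBox m n), wallCoupling m J t e * bond σ e =
      ∑ e ∈ touchingEdges (doubleBox m n), J * bond σ e
        - t * ∑ i ∈ wallBox m n, J * (spin i σ * spin (i - lastVec m) σ) := by
    have h2 := sum_crossing_edges hn fun e => J * bond σ e
    have h3 : ∑ i ∈ wallBox m n, J * bond σ s(i, i - lastVec m) =
      ∑ i ∈ wallBox m n, J * (spin i σ * spin (i - lastVec m) σ) := rfl
    rw [← h3, ← h2, Finset.sum_filter, Finset.mul_sum, ← Finset.sum_sub_distrib]
    refine Finset.sum_congr rfl fun e _ => ?_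
    unfold wallCoupling
    split_ifs with h4 <;> first | contradiction | ring
  simp only [isingHamiltonian, wallPerturbation, pairHamiltonian, h1, mul_assoc, zero_mul,
    Finset.sum_const_zero, ← Finset.mul_sum]
  ring

theorem boxState_eq {n : ℕ} (hn : 1 ≤ n) (ε : ℤˣ) (J lam : ℝ) (h : ℕ → ℝ) (t : ℝ)
    (f : Config m → ℝ) :
    boxState m ε J lam h n t f = gibbsExpectation (doubleBox m n) (constConfig m ε)
      (pairHamiltonian (doubleBox m n) (wallCoupling m J t)
        fun i => t * extendedField (addWall lam h) i) f :=
  gibbsExpectation_congr (fun σ _ => interpolation_eq_pairHamiltonian hn J lam h t σ)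
    fun _ _ => rfl

theorem extendedField_eq (h : ℕ → ℝ) (i : Site m) : extendedField h i =
    if 1 ≤ i (Fin.last m) then h (i (Fin.last m)).toNat else h (1 - i (Fin.last m)).toNat := by
  have : (-i + lastVec m) (Fin.last m) = 1 - i (Fin.last m) := by
    rw [Pi.add_apply, Pi.neg_apply, lastVec_last]
    ring
  simp only [extendedField, inducedField, mem_halfSpace, this]

theorem halfSpace_add {v : Site m} (hv : v (Fin.last m) = 0) (i : Site m) :
    i + v ∈ halfSpace m ↔ i ∈ halfSpace m := by
  rw [mem_halfSpace, mem_halfSpace, Pi.add_apply, hv, add_zero]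

theorem wallCoupling_translate (J t : ℝ) {v : Site m} (hv : v (Fin.last m) = 0)
    (e : Sym2 (Site m)) : wallCoupling m J t (e.map (· + v)) = wallCoupling m J t e := by
  have : OneSided (e.map (· + v)) ↔ OneSided e := by
    induction e using Sym2.ind with
    | _ i j => simp [OneSided, Sym2.map_mk, halfSpace_add hv]
  classical
  unfold wallCoupling
  exact if_congr this rfl rfl

theorem extendedField_translate (h : ℕ → ℝ) {v : Site m} (hv : v (Fin.last m) = 0)
    (i : Site m) : extendedField h (i + v) = extendedField h i := by
  rw [extendedField_eq, extendedField_eq, Pi.add_apply, hv, add_zero]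

/-- Monotonicity of the states of translated boxes. -/
theorem gibbsExpectation_doubleBox_translate {n : ℕ} (hn : 1 ≤ n) (ε : ℤˣ) (J lam : ℝ)
    (h : ℕ → ℝ) (t : ℝ) (f : Config m → ℝ) {v : Site m} (hv : v (Fin.last m) = 0) :
    boxState m ε J lam h n t (fun σ => f (shift v σ)) =
      gibbsExpectation ((doubleBox m n).map (Equiv.addRight (-v)).toEmbedding) (constConfig m ε)
        (pairHamiltonian ((doubleBox m n).map (Equiv.addRight (-v)).toEmbedding)
          (wallCoupling m J t) fun i => t * extendedField (addWall lam h) i) f := by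
  rw [boxState_eq hn]
  exact gibbsExpectation_shift _ v ε (fun e => wallCoupling_translate J t hv e)
    (fun i => by rw [extendedField_translate _ hv]) f

/-- When the horizontal shift is at most n - k, the translated box Δ_n - v still contains Δ_k. -/
theorem boxState_shift_le {k n : ℕ} (hk : 1 ≤ k) (hkn : k ≤ n) (ε : ℤˣ) {J : ℝ} (hJ : 0 ≤ J)
    (lam : ℝ) (h : ℕ → ℝ) {t : ℝ} (ht : t ≤ 1) {f : Config m → ℝ} (hf : Monotone f) {v : Site m}
    (hv : v (Fin.last m) = 0)
    (hvn : ∀ l : Fin m, -((n - k : ℕ) : ℤ) ≤ v l.castSucc ∧ v l.castSucc ≤ (n - k : ℕ)) :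
    (ε : ℤ) * boxState m ε J lam h n t (fun σ => f (shift v σ)) ≤
      (ε : ℤ) * boxState m ε J lam h k t f := by
  rw [gibbsExpectation_doubleBox_translate (hk.trans hkn) ε J lam h t f hv, boxState_eq hk]
  refine gibbsExpectation_volume_mono (fun i hi => ?_) ε (wallCoupling_nonneg hJ ht) _ hf
  rw [mem_doubleBox] at hi
  simp only [Finset.mem_map_equiv, Equiv.addRight_symm, Equiv.coe_addRight, neg_neg,
    mem_doubleBox, Pi.add_apply, hv]
  refine ⟨fun l => ?_, by omega, by omega⟩
  have := hi.1 l
  have := hvn l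
  omega

/-- The companion inclusion: Δ_k - v lies inside Δ_n. -/
theorem le_boxState_shift {k n : ℕ} (hk : 1 ≤ k) (hkn : k ≤ n) (ε : ℤˣ) {J : ℝ} (hJ : 0 ≤ J)
    (lam : ℝ) (h : ℕ → ℝ) {t : ℝ} (ht : t ≤ 1) {f : Config m → ℝ} (hf : Monotone f) {v : Site m}
    (hv : v (Fin.last m) = 0)
    (hvn : ∀ l : Fin m, -((n - k : ℕ) : ℤ) ≤ v l.castSucc ∧ v l.castSucc ≤ (n - k : ℕ)) :
    (ε : ℤ) * boxState m ε J lam h n t f ≤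
      (ε : ℤ) * boxState m ε J lam h k t (fun σ => f (shift v σ)) := by
  rw [gibbsExpectation_doubleBox_translate hk ε J lam h t f hv, boxState_eq (hk.trans hkn)]
  refine gibbsExpectation_volume_mono (fun i hi => ?_) ε (wallCoupling_nonneg hJ ht) _ hf
  simp only [Finset.mem_map_equiv, Equiv.addRight_symm, Equiv.coe_addRight, neg_neg,
    mem_doubleBox, Pi.add_apply, hv] at hi
  rw [mem_doubleBox]
  refine ⟨fun l => ?_, by omega, by omega⟩
  have := hi.1 l
  have := hvn l
  omega

/-! ### Convergence of the states and of their wall averages. -/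

/-- The average of the translates of an observable along the finite wall. -/
def wallAverage (m : ℕ) (ε : ℤˣ) (J lam : ℝ) (h : ℕ → ℝ) (n : ℕ) (t : ℝ)
    (f : Config m → ℝ) : ℝ :=
  (∑ i ∈ wallBox m n, boxState m ε J lam h n t fun σ => f (shift (i - lastVec m) σ)) /
    (wallBox m n).card

theorem card_wallBox_pos (n : ℕ) : (0 : ℝ) < (wallBox m n).card := by
  rw [card_wallBox]
  positivity

theorem tendsto_card_wallBox_ratio (k : ℕ) :
    Tendsto (fun n : ℕ => ((wallBox m (n - k)).card : ℝ) / (wallBox m n).card) atTop (𝓝 1) := by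
  rw [← tendsto_add_atTop_iff_nat k]
  simp only [Nat.add_sub_cancel, card_wallBox, Nat.cast_pow, ← div_pow]
  rw [show (1 : ℝ) = (1 - 0) ^ m by simp]
  refine Tendsto.pow ?_ m
  have h1 : Tendsto (fun n : ℕ => 1 - (2 * k : ℝ) / (2 * (n + k : ℕ) + 1 : ℕ)) atTop
      (𝓝 (1 - 0)) := by
    refine tendsto_const_nhds.sub (tendsto_const_nhds.div_atTop ?_)
    refine tendsto_natCast_atTop_atTop.comp (tendsto_atTop_mono (fun n => ?_) tendsto_id)
    simp only [id]
    omega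
  refine h1.congr fun n => ?_
  push_cast
  field_simp
  ring

theorem abs_boxState_le (ε : ℤˣ) (J lam : ℝ) (h : ℕ → ℝ) (n : ℕ) (t : ℝ) {f : Config m → ℝ}
    {C : ℝ} (hf : ∀ σ, |f σ| ≤ C) : |boxState m ε J lam h n t f| ≤ C :=
  abs_gibbsExpectation_le _ _ _ hf

theorem abs_wallAverage_le (ε : ℤˣ) (J lam : ℝ) (h : ℕ → ℝ) (n : ℕ) (t : ℝ) {f : Config m → ℝ}
    {C : ℝ} (hf : ∀ σ, |f σ| ≤ C) : |wallAverage m ε J lam h n t f| ≤ C := by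
  rw [wallAverage, abs_div, abs_of_pos (card_wallBox_pos n), div_le_iff₀ (card_wallBox_pos n)]
  refine (Finset.abs_sum_le_sum_abs _ _).trans ((Finset.sum_le_sum fun i _ =>
    abs_boxState_le ε J lam h n t fun σ => hf (shift (i - lastVec m) σ)).trans ?_)
  rw [Finset.sum_const, nsmul_eq_mul, mul_comm]

theorem abs_sign (ε : ℤˣ) : |((ε : ℤ) : ℝ)| = 1 := by
  rcases Int.units_eq_one_or ε with rfl | rfl <;> simp

theorem sign_mul_sign (ε : ℤˣ) : ((ε : ℤ) : ℝ) * (ε : ℤ) = 1 := by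
  rcases Int.units_eq_one_or ε with rfl | rfl <;> simp

/-- The states and their averages along the wall converge to the same limit. -/
theorem exists_tendsto_of_monotone (ε : ℤˣ) {J : ℝ} (hJ : 0 ≤ J) (lam : ℝ) (h : ℕ → ℝ) {t : ℝ}
    (ht : t ≤ 1) {f : Config m → ℝ} (hf : Monotone f) {C : ℝ} (hC : ∀ σ, |f σ| ≤ C) :
    ∃ L, Tendsto (fun n => boxState m ε J lam h n t f) atTop (𝓝 L) ∧
      Tendsto (fun n => wallAverage m ε J lam h n t f) atTop (𝓝 L) := by
  set u : ℕ → ℝ := fun n => (ε : ℤ) * boxState m ε J lam h n t f with hu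
  have hshift0 : ∀ σ : Config m, shift 0 σ = σ := fun σ => by funext i; simp [shift]
  have hanti : ∀ k n, 1 ≤ k → k ≤ n → u n ≤ u k := fun k n hk hkn => by
    have := boxState_shift_le hk hkn ε hJ lam h ht hf (v := 0) rfl (fun l => by simp)
    simpa only [hshift0] using this
  have habs : ∀ n, |u n| ≤ C := fun n => by
    rw [hu, abs_mul, abs_sign, one_mul]
    exact abs_boxState_le ε J lam h n t hC
  -- Monotonicity has been established only from n = 1 on, hence the shifted index.
  have hbdd : BddBelow (Set.range fun n => u (n + 1)) :=
    ⟨-C, by rintro _ ⟨n, rfl⟩; exact (abs_le.1 (habs _)).1⟩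
  have hlim := tendsto_atTop_ciInf (f := fun n => u (n + 1))
    (fun a b hab => hanti _ _ (by omega) (by omega)) hbdd
  rw [tendsto_add_atTop_iff_nat 1] at hlim
  set L := ⨅ n, u (n + 1) with hL
  have hLle : ∀ n, 1 ≤ n → L ≤ u n := fun n hn => by
    have := ciInf_le hbdd (n - 1)
    rwa [Nat.sub_add_cancel hn] at this
  have hwall : ∀ n, ∀ i ∈ wallBox m n, (i - lastVec m) (Fin.last m) = 0 ∧
      ∀ l : Fin m, -(n : ℤ) ≤ (i - lastVec m) l.castSucc ∧ (i - lastVec m) l.castSucc ≤ n := by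
    intro n i hi
    rw [mem_wallBox] at hi
    simp only [Pi.sub_apply, lastVec_last, lastVec_castSucc, sub_zero]
    exact ⟨by omega, hi.1⟩
  set w : ℕ → Site m → ℝ := fun n i =>
    (ε : ℤ) * boxState m ε J lam h n t (fun σ => f (shift (i - lastVec m) σ)) with hw
  have havg : ∀ n, (ε : ℤ) * wallAverage m ε J lam h n t f =
      (∑ i ∈ wallBox m n, w n i) / (wallBox m n).card := fun n => by
    rw [wallAverage, ← mul_div_assoc, Finset.mul_sum]
  have hwC : ∀ n i, w n i ≤ C := fun n i => by
    refine (le_abs_self _).trans ?_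
    rw [hw, abs_mul, abs_sign, one_mul]
    exact abs_boxState_le ε J lam h n t fun σ => hC _
  -- A shift within the wall has size at most n, so every translated box Δ_n - v lies in Δ_{2n} and
  -- every term of the average is at least `u (2 * n)`.
  have hlow : ∀ n, 1 ≤ n → L ≤ (ε : ℤ) * wallAverage m ε J lam h n t f := fun n hn => by
    rw [havg, le_div_iff₀ (card_wallBox_pos n), mul_comm, ← nsmul_eq_mul]
    refine Finset.card_nsmul_le_sum _ _ _ fun i hi => (hLle (2 * n) (by omega)).trans ?_
    refine le_boxState_shift hn (by omega) ε hJ lam h ht hf (hwall n i hi).1 ?_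
    rw [show 2 * n - n = n by omega]
    exact (hwall n i hi).2
  -- For wall sites in W_{n-k} the translated box contains Δ_k, so the term is at most `u k`; the
  -- remaining sites, a rim of width k, are bounded by `C`.
  have hup : ∀ k n, 1 ≤ k → k ≤ n → (ε : ℤ) * wallAverage m ε J lam h n t f ≤
      ((wallBox m (n - k)).card : ℝ) / (wallBox m n).card * u k
        + (1 - ((wallBox m (n - k)).card : ℝ) / (wallBox m n).card) * C := by
    intro k n hk hkn
    classical
    have hsub : wallBox m (n - k) ⊆ wallBox m n := fun i hi => by
      rw [mem_wallBox] at hi ⊢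
      refine ⟨fun l => ?_, hi.2⟩
      have := hi.1 l
      omega
    have hin : ∑ i ∈ wallBox m (n - k), w n i ≤ (wallBox m (n - k)).card * u k := by
      rw [← nsmul_eq_mul]
      refine Finset.sum_le_card_nsmul _ _ _ fun i hi => ?_
      exact boxState_shift_le hk hkn ε hJ lam h ht hf (hwall _ i hi).1 (hwall _ i hi).2
    have hout : ∑ i ∈ wallBox m n \ wallBox m (n - k), w n i ≤
        ((wallBox m n).card - (wallBox m (n - k)).card : ℝ) * C := by
      rw [← Nat.cast_sub (Finset.card_le_card hsub), ← Finset.card_sdiff_of_subset hsub,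
        ← nsmul_eq_mul]
      exact Finset.sum_le_card_nsmul _ _ _ fun i _ => hwC n i
    have hne := (card_wallBox_pos (m := m) n).ne'
    rw [havg, div_le_iff₀ (card_wallBox_pos n), ← Finset.sum_sdiff hsub, add_comm]
    refine (add_le_add hin hout).trans (le_of_eq ?_)
    field_simp
  have hlimavg : Tendsto (fun n => (ε : ℤ) * wallAverage m ε J lam h n t f) atTop (𝓝 L) := by
    rw [tendsto_order]
    constructor
    · intro a ha
      filter_upwards [eventually_ge_atTop 1] with n hn
      exact ha.trans_le (hlow n hn)
    · intro a ha
      -- First fix k with `u k` below the target, then let n grow so that the rim becomes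
      -- negligible.
      obtain ⟨k, hka, hk⟩ := (((tendsto_order.1 hlim).2 a ha).and (eventually_ge_atTop 1)).exists
      have hr := tendsto_card_wallBox_ratio (m := m) k
      have hrhs := (hr.mul_const (u k)).add ((tendsto_const_nhds (x := (1 : ℝ))).sub hr |>.mul_const C)
      rw [one_mul, sub_self, zero_mul, add_zero] at hrhs
      filter_upwards [(tendsto_order.1 hrhs).2 a hka, eventually_ge_atTop k] with n h1 h2
      exact (hup k n hk h2).trans_lt h1
  refine ⟨(ε : ℤ) * L, ?_, ?_⟩
  · refine (hlim.const_mul ((ε : ℤ) : ℝ)).congr fun n => ?_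
    rw [hu, ← mul_assoc, sign_mul_sign, one_mul]
  · refine (hlimavg.const_mul ((ε : ℤ) : ℝ)).congr fun n => ?_
    rw [← mul_assoc, sign_mul_sign, one_mul]

theorem wallAverage_sub (ε : ℤˣ) (J lam : ℝ) (h : ℕ → ℝ) (n : ℕ) (t : ℝ) (f g : Config m → ℝ) :
    wallAverage m ε J lam h n t (fun σ => f σ - g σ) =
      wallAverage m ε J lam h n t f - wallAverage m ε J lam h n t g := by
  simp only [wallAverage, boxState]
  rw [← sub_div, ← Finset.sum_sub_distrib]
  simp only [gibbsExpectation_sub]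

theorem exists_tendsto_of_dependsOn (ε : ℤˣ) {J : ℝ} (hJ : 0 ≤ J) (lam : ℝ) (h : ℕ → ℝ) {t : ℝ}
    (ht : t ≤ 1) {f : Config m → ℝ} {A : Finset (Site m)}
    (hf : DependsOn f (A : Set (Site m))) :
    ∃ L, Tendsto (fun n => boxState m ε J lam h n t f) atTop (𝓝 L) ∧
      Tendsto (fun n => wallAverage m ε J lam h n t f) atTop (𝓝 L) := by
  obtain ⟨g, k, hg, hk, ⟨C, hC⟩, ⟨D, hD⟩, rfl⟩ := exists_monotone_sub hf
  obtain ⟨L, h1, h2⟩ := exists_tendsto_of_monotone ε hJ lam h ht hg hC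
  obtain ⟨M, h3, h4⟩ := exists_tendsto_of_monotone ε hJ lam h ht hk hD
  refine ⟨L - M, (h1.sub h3).congr fun n => ?_, (h2.sub h4).congr fun n => ?_⟩
  · exact (gibbsExpectation_sub _ _ _ _ _).symm
  · exact (wallAverage_sub ε J lam h n t g k).symm

theorem tendsto_boxState (ε : ℤˣ) {J : ℝ} (hJ : 0 ≤ J) (lam : ℝ) (h : ℕ → ℝ) {t : ℝ}
    (ht : t ≤ 1) {f : Config m → ℝ} {A : Finset (Site m)}
    (hf : DependsOn f (A : Set (Site m))) :
    Tendsto (fun n => boxState m ε J lam h n t f) atTop (𝓝 (limitState m ε J lam h t f)) := by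
  obtain ⟨L, h1, -⟩ := exists_tendsto_of_dependsOn ε hJ lam h ht hf
  rwa [limitState, h1.limUnder_eq]

theorem tendsto_wallAverage (ε : ℤˣ) {J : ℝ} (hJ : 0 ≤ J) (lam : ℝ) (h : ℕ → ℝ) {t : ℝ}
    (ht : t ≤ 1) {f : Config m → ℝ} {A : Finset (Site m)}
    (hf : DependsOn f (A : Set (Site m))) :
    Tendsto (fun n => wallAverage m ε J lam h n t f) atTop
      (𝓝 (limitState m ε J lam h t f)) := by
  obtain ⟨L, h1, h2⟩ := exists_tendsto_of_dependsOn ε hJ lam h ht hf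
  rwa [limitState, h1.limUnder_eq]

/-! ### Dependence on the interpolation parameter. -/

theorem hasDerivAt_log_partitionFunction (Λ : Finset (Site m)) (η : Config m)
    (H P : Config m → ℝ) (t : ℝ) :
    HasDerivAt (fun s => Real.log (partitionFunction Λ η fun σ => H σ + s * P σ))
      (-gibbsExpectation Λ η (fun σ => H σ + t * P σ) P) t := by
  have h1 : HasDerivAt (fun s => partitionFunction Λ η fun σ => H σ + s * P σ)
      (∑ τ : Λ → ℤˣ, -(P (glue Λ η τ) * Real.exp (-(H (glue Λ η τ) + t * P (glue Λ η τ))))) t := by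
    unfold partitionFunction
    refine HasDerivAt.fun_sum fun τ _ => ?_
    have h2 : HasDerivAt (fun s => -(H (glue Λ η τ) + s * P (glue Λ η τ)))
        (-(1 * P (glue Λ η τ))) t :=
      (((hasDerivAt_id t).mul_const _).const_add _).neg
    refine h2.exp.congr_deriv ?_
    ring
  refine (h1.log (partitionFunction_pos _ _ _).ne').congr_deriv ?_
  rw [Finset.sum_neg_distrib, neg_div]
  rfl

theorem continuous_gibbsExpectation (Λ : Finset (Site m)) (η : Config m)
    (H P f : Config m → ℝ) :
    Continuous fun t : ℝ => gibbsExpectation Λ η (fun σ => H σ + t * P σ) f := by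
  unfold gibbsExpectation
  refine Continuous.div ?_ ?_ fun t => (partitionFunction_pos _ _ _).ne'
  · fun_prop
  · unfold partitionFunction
    fun_prop

theorem continuous_boxState (ε : ℤˣ) (J lam : ℝ) (h : ℕ → ℝ) (n : ℕ) (f : Config m → ℝ) :
    Continuous fun t => boxState m ε J lam h n t f :=
  continuous_gibbsExpectation _ _ _ _ _

theorem continuous_wallAverage (ε : ℤˣ) (J lam : ℝ) (h : ℕ → ℝ) (n : ℕ) (f : Config m → ℝ) :
    Continuous fun t => wallAverage m ε J lam h n t f :=
  (continuous_finsetSum _ fun _ _ => continuous_boxState ε J lam h n _).div_const _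

/-! ### Reflection and decoupling at t = 1. -/

/-- The configuration reflected with respect to the wall. -/
def reflectConfig (σ : Config m) : Config m := fun i => σ (reflect i)

theorem bond_reflectConfig (σ : Config m) (e : Sym2 (Site m)) :
    bond (reflectConfig σ) e = bond σ (e.map reflect) := by
  induction e using Sym2.ind with
  | _ i j => rfl

theorem reflect_mem_halfSpace (i : Site m) : reflect i ∈ halfSpace m ↔ i ∉ halfSpace m := by
  rw [mem_halfSpace, mem_halfSpace, reflect_last]
  omega

theorem reflect_adj {i j : Site m} (h : (lattice m).Adj i j) :
    (lattice m).Adj (reflect i) (reflect j) := by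
  change ∑ k, |i k - j k| = 1 at h
  change ∑ k, |reflect i k - reflect j k| = 1
  rw [Fin.sum_univ_castSucc] at h ⊢
  simp only [reflect_castSucc, reflect_last]
  rw [sub_sub_sub_cancel_left, abs_sub_comm (j (Fin.last m))]
  exact h

theorem mem_box_iff {n : ℕ} {i : Site m} : i ∈ box m n ↔ i ∈ doubleBox m n ∧ i ∈ halfSpace m := by
  rw [mem_box, mem_doubleBox, mem_halfSpace]
  constructor
  · rintro ⟨h1, h2, h3⟩
    exact ⟨⟨h1, by omega, h3⟩, h2⟩
  · rintro ⟨⟨h1, -, h3⟩, h2⟩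
    exact ⟨h1, h2, h3⟩

theorem reflect_mem_doubleBox {n : ℕ} {i : Site m} :
    reflect i ∈ doubleBox m n ↔ i ∈ doubleBox m n := by
  rw [mem_doubleBox, mem_doubleBox, reflect_last]
  simp only [reflect_castSucc]
  constructor <;> rintro ⟨h1, h2, h3⟩ <;> exact ⟨h1, by omega, by omega⟩

theorem sum_doubleBox (n : ℕ) (F : Site m → ℝ) :
    ∑ i ∈ doubleBox m n, F i = ∑ i ∈ box m n, (F i + F (reflect i)) := by
  classical
  rw [← Finset.sum_filter_add_sum_filter_not (doubleBox m n) fun i => i ∈ halfSpace m,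
    Finset.sum_add_distrib]
  congr 1
  · refine Finset.sum_congr ?_ fun _ _ => rfl
    ext i
    rw [Finset.mem_filter, mem_box_iff]
  · refine Finset.sum_bij' (fun i _ => reflect i) (fun i _ => reflect i) ?_ ?_ ?_ ?_ ?_
    · intro i hi
      rw [Finset.mem_filter] at hi
      rw [mem_box_iff, reflect_mem_doubleBox, reflect_mem_halfSpace]
      exact hi
    · intro i hi
      rw [mem_box_iff] at hi
      rw [Finset.mem_filter, reflect_mem_doubleBox, reflect_mem_halfSpace, not_not]
      exact hi
    · exact fun i _ => reflect_reflect i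
    · exact fun i _ => reflect_reflect i
    · exact fun i _ => by rw [reflect_reflect]

theorem extendedField_of_mem_box (h : ℕ → ℝ) {n : ℕ} {i : Site m} (hi : i ∈ box m n) :
    extendedField h i = h (i (Fin.last m)).toNat ∧
      extendedField h (reflect i) = h (i (Fin.last m)).toNat := by
  rw [mem_box] at hi
  rw [extendedField_eq, extendedField_eq, reflect_last, if_pos hi.2.1, if_neg (by omega),
    sub_sub_cancel]
  exact ⟨rfl, rfl⟩

theorem sum_extendedField (h : ℕ → ℝ) (n : ℕ) (σ : Config m) :
    ∑ i ∈ doubleBox m n, extendedField h i * spin i σ =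
      ∑ i ∈ box m n, h (i (Fin.last m)).toNat * (spin i σ + spin (reflect i) σ) := by
  rw [sum_doubleBox]
  refine Finset.sum_congr rfl fun i hi => ?_
  rw [(extendedField_of_mem_box h hi).1, (extendedField_of_mem_box h hi).2, mul_add]

open scoped Classical in
theorem touchingEdges_box_filter (n : ℕ) :
    (touchingEdges (box m n)).filter (fun e => ∀ i ∈ e, i ∈ halfSpace m) =
      (touchingEdges (doubleBox m n)).filter fun e => ∀ i ∈ e, i ∈ halfSpace m := by
  ext e
  simp only [Finset.mem_filter, mem_touchingEdges, mem_box_iff]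
  constructor
  · rintro ⟨⟨h1, i, hi, hie⟩, h2⟩
    exact ⟨⟨h1, i, hi.1, hie⟩, h2⟩
  · rintro ⟨⟨h1, i, hi, hie⟩, h2⟩
    exact ⟨⟨h1, i, ⟨hi, h2 i hie⟩, hie⟩, h2⟩

theorem map_reflect_reflect (e : Sym2 (Site m)) : (e.map reflect).map reflect = e := by
  induction e using Sym2.ind with
  | _ i j => simp [reflect_reflect]

open scoped Classical in
theorem sum_reflected_edges (n : ℕ) (F : Sym2 (Site m) → ℝ) :
    ∑ e ∈ (touchingEdges (doubleBox m n)).filter (fun e => ∀ i ∈ e, i ∉ halfSpace m), F e =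
      ∑ e ∈ (touchingEdges (box m n)).filter (fun e => ∀ i ∈ e, i ∈ halfSpace m),
        F (e.map reflect) := by
  rw [touchingEdges_box_filter]
  have hmem : ∀ e ∈ touchingEdges (doubleBox m n),
      e.map reflect ∈ touchingEdges (doubleBox m n) := by
    intro e he
    rw [mem_touchingEdges] at he ⊢
    obtain ⟨h1, i, hi, hie⟩ := he
    refine ⟨?_, reflect i, reflect_mem_doubleBox.2 hi, Sym2.mem_map.2 ⟨i, hie, rfl⟩⟩
    induction e using Sym2.ind with
    | _ i j => exact reflect_adj h1
  refine Finset.sum_bij' (fun e _ => e.map reflect) (fun e _ => e.map reflect) ?_ ?_ ?_ ?_ ?_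
  · intro e he
    rw [Finset.mem_filter] at he ⊢
    refine ⟨hmem e he.1, fun i hi => ?_⟩
    obtain ⟨j, hj, rfl⟩ := Sym2.mem_map.1 hi
    exact (reflect_mem_halfSpace j).2 (he.2 j hj)
  · intro e he
    rw [Finset.mem_filter] at he ⊢
    refine ⟨hmem e he.1, fun i hi => ?_⟩
    obtain ⟨j, hj, rfl⟩ := Sym2.mem_map.1 hi
    rw [reflect_mem_halfSpace, not_not]
    exact he.2 j hj
  · exact fun e _ => map_reflect_reflect e
  · exact fun e _ => map_reflect_reflect e
  · exact fun e _ => by rw [map_reflect_reflect]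

-- The wall parameter acts only on the sites at height 1, so it is absorbed into the first term of
-- the field sequence.
open scoped Classical in
theorem semiInfiniteHamiltonian_eq (n : ℕ) (J lam : ℝ) (h : ℕ → ℝ) (σ : Config m) :
    semiInfiniteHamiltonian (box m n) J lam (inducedField h) σ =
      -(∑ e ∈ (touchingEdges (box m n)).filter (fun e => ∀ i ∈ e, i ∈ halfSpace m), J * bond σ e)
        - ∑ i ∈ box m n, addWall lam h (i (Fin.last m)).toNat * spin i σ := by
  rw [semiInfiniteHamiltonian, sub_sub, Finset.sum_filter (s := box m n),
    ← Finset.sum_add_distrib]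
  congr 1
  refine Finset.sum_congr rfl fun i hi => ?_
  rw [mem_box] at hi
  have : (i (Fin.last m)).toNat = 1 ↔ i (Fin.last m) = 1 := by omega
  simp only [addWall, inducedField, this]
  split_ifs <;> ring

/-- At the end of the interpolation the two half-spaces decouple. -/
theorem interpolation_one {n : ℕ} (hn : 1 ≤ n) (J lam : ℝ) (h : ℕ → ℝ) (σ : Config m) :
    isingHamiltonian (doubleBox m n) J (fun _ => 0) σ + 1 * wallPerturbation J lam h n σ =
      semiInfiniteHamiltonian (box m n) J lam (inducedField h) σ +
        semiInfiniteHamiltonian (box m n) J lam (inducedField h) (reflectConfig σ) := by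
  classical
  have hne : ∀ e : Sym2 (Site m), ∃ i, i ∈ e := fun e => by
    induction e using Sym2.ind with
    | _ i j => exact ⟨i, Sym2.mem_mk_left i j⟩
  have h1 : ∑ e ∈ touchingEdges (doubleBox m n), wallCoupling m J 1 e * bond σ e =
      ∑ e ∈ (touchingEdges (doubleBox m n)).filter (fun e => ∀ i ∈ e, i ∈ halfSpace m),
          J * bond σ e +
        ∑ e ∈ (touchingEdges (doubleBox m n)).filter (fun e => ∀ i ∈ e, i ∉ halfSpace m),
          J * bond σ e := by
    rw [Finset.sum_filter, Finset.sum_filter, ← Finset.sum_add_distrib]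
    refine Finset.sum_congr rfl fun e _ => ?_
    obtain ⟨i, hi⟩ := hne e
    unfold wallCoupling OneSided
    by_cases h2 : ∀ i ∈ e, i ∈ halfSpace m
    · have h3 : ¬ ∀ i ∈ e, i ∉ halfSpace m := fun h3 => h3 i hi (h2 i hi)
      rw [if_pos (Or.inl h2), if_pos h2, if_neg h3, add_zero]
    · by_cases h3 : ∀ i ∈ e, i ∉ halfSpace m
      · rw [if_pos (Or.inr h3), if_neg h2, if_pos h3, zero_add]
      · rw [if_neg (by tauto), if_neg h2, if_neg h3]
        ring
  rw [interpolation_eq_pairHamiltonian hn, pairHamiltonian, h1, sum_reflected_edges,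
    ← touchingEdges_box_filter, semiInfiniteHamiltonian_eq, semiInfiniteHamiltonian_eq]
  simp only [one_mul, sum_extendedField, bond_reflectConfig, mul_add, Finset.sum_add_distrib]
  have h4 : ∀ i : Site m, spin i (reflectConfig σ) = spin (reflect i) σ := fun _ => rfl
  simp only [h4]
  ring

theorem semiInfiniteHamiltonian_congr (n : ℕ) (J lam : ℝ) (h : ℕ → ℝ) {σ σ' : Config m}
    (hσ : ∀ i ∈ halfSpace m, σ i = σ' i) :
    semiInfiniteHamiltonian (box m n) J lam (inducedField h) σ =
      semiInfiniteHamiltonian (box m n) J lam (inducedField h) σ' := by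
  classical
  rw [semiInfiniteHamiltonian_eq, semiInfiniteHamiltonian_eq]
  congr 1
  · refine congrArg _ (Finset.sum_congr rfl fun e he => ?_)
    rw [Finset.mem_filter] at he
    rw [bond_congr fun i hi => hσ i (he.2 i hi)]
  · refine Finset.sum_congr rfl fun i hi => ?_
    rw [spin, hσ i (mem_box_iff.1 hi).2, spin]

/-- A configuration in Δ_n is the same as a pair of configurations in Λ_n: its upper half and the
reflection of its lower half. The energy is additive over the pair, so the sum factors. -/
theorem partitionFunction_interpolation_one {n : ℕ} (hn : 1 ≤ n) (ε : ℤˣ) (J lam : ℝ)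
    (h : ℕ → ℝ) :
    partitionFunction (doubleBox m n) (constConfig m ε)
        (fun σ => isingHamiltonian (doubleBox m n) J (fun _ => 0) σ
          + 1 * wallPerturbation J lam h n σ) =
      partitionFunction (box m n) (constConfig m ε)
        (semiInfiniteHamiltonian (box m n) J lam (inducedField h)) ^ 2 := by
  classical
  set S := semiInfiniteHamiltonian (box m n) J lam (inducedField h) with hS
  rw [partitionFunction_eq, partitionFunction_eq, sq, Finset.sum_mul_sum, ← Finset.sum_product']
  -- Configurations for Λ_n must equal ε on the whole lower half-space; resetting the spins there is
  -- harmless because the semi-infinite energy does not see them.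
  let up : Config m → Config m := fun σ i => if i ∈ halfSpace m then σ i else ε
  let join : Config m → Config m → Config m :=
    fun a b i => if i ∈ halfSpace m then a i else b (reflect i)
  have hup : ∀ σ, S (up σ) = S σ := fun σ =>
    semiInfiniteHamiltonian_congr n J lam h fun i hi => if_pos hi
  have hupmem : ∀ σ : Config m, (∀ i ∈ halfSpace m, i ∉ doubleBox m n → σ i = ε) →
      up σ ∈ configs (box m n) (constConfig m ε) := by
    intro σ hσ
    rw [mem_configs]
    intro i hi
    simp only [up, constConfig]
    split_ifs with h1
    · exact hσ i h1 fun h2 => hi (mem_box_iff.2 ⟨h2, h1⟩)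
    · rfl
  refine Finset.sum_bij' (fun σ _ => (up σ, up (reflectConfig σ))) (fun p _ => join p.1 p.2)
    ?_ ?_ ?_ ?_ ?_
  · intro σ hσ
    rw [mem_configs] at hσ
    rw [Finset.mem_product]
    refine ⟨hupmem _ fun i _ hi => hσ i hi, hupmem _ fun i _ hi => hσ _ fun h2 => hi ?_⟩
    exact reflect_mem_doubleBox.1 h2
  · rintro ⟨a, b⟩ hab
    rw [Finset.mem_product, mem_configs, mem_configs] at hab
    rw [mem_configs]
    intro i hi
    simp only [join]
    split_ifs with h1
    · exact hab.1 i fun h2 => hi (mem_box_iff.1 h2).1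
    · exact hab.2 _ fun h2 => hi (reflect_mem_doubleBox.1 (mem_box_iff.1 h2).1)
  · intro σ _
    funext i
    simp only [join, up, reflectConfig, reflect_mem_halfSpace, reflect_reflect]
    by_cases hi : i ∈ halfSpace m <;> simp [hi]
  · rintro ⟨a, b⟩ hab
    rw [Finset.mem_product, mem_configs, mem_configs] at hab
    simp only [Prod.mk.injEq]
    constructor
    · funext i
      simp only [join, up]
      split_ifs with hi
      · rfl
      · exact (hab.1 i fun h2 => hi (mem_box_iff.1 h2).2).symm
    · funext i
      simp only [join, up, reflectConfig, reflect_mem_halfSpace, reflect_reflect]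
      by_cases hi : i ∈ halfSpace m
      · simp [hi]
      · simpa [hi, constConfig] using (hab.2 i fun h2 => hi (mem_box_iff.1 h2).2).symm
  · intro σ _
    rw [interpolation_one hn, ← hS, neg_add, Real.exp_add, hup, hup]

/-! ### The perturbation layer by layer, and the integral formula in finite volume. -/

/-- The pair of spins across the wall at the origin. -/
def wallPair (m : ℕ) (σ : Config m) : ℝ := spin (lastVec m) σ * spin 0 σ

/-- The spins of the two sites at height `ℓ` above and below the wall. -/
def layerPair (m ℓ : ℕ) (σ : Config m) : ℝ :=
  spin ((ℓ : ℤ) • lastVec m) σ + spin (-((ℓ : ℤ) - 1) • lastVec m) σ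

theorem sum_box (n : ℕ) (F : Site m → ℝ) :
    ∑ i ∈ box m n, F i =
      ∑ ℓ ∈ Finset.range n, ∑ i ∈ wallBox m n, F (i + (ℓ : ℤ) • lastVec m) := by
  rw [← Finset.sum_product']
  refine Finset.sum_bij' (fun i _ => ((i (Fin.last m) - 1).toNat,
    i - ((i (Fin.last m) - 1).toNat : ℤ) • lastVec m))
    (fun p _ => p.2 + (p.1 : ℤ) • lastVec m) ?_ ?_ ?_ ?_ ?_
  · intro i hi
    rw [mem_box] at hi
    rw [Finset.mem_product, Finset.mem_range, mem_wallBox]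
    simp only [Pi.sub_apply, Pi.smul_apply, lastVec_last, lastVec_castSucc, smul_eq_mul, mul_zero,
      sub_zero, mul_one]
    exact ⟨by omega, hi.1, by omega⟩
  · rintro ⟨ℓ, i⟩ hp
    rw [Finset.mem_product, Finset.mem_range, mem_wallBox] at hp
    rw [mem_box]
    simp only [Pi.add_apply, Pi.smul_apply, lastVec_last, lastVec_castSucc, smul_eq_mul, mul_zero,
      add_zero, mul_one] at hp ⊢
    exact ⟨hp.2.1, by omega, by omega⟩
  · intro i _
    simp
  · rintro ⟨ℓ, i⟩ hp
    rw [Finset.mem_product, Finset.mem_range, mem_wallBox] at hp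
    have h1 : ((i + (ℓ : ℤ) • lastVec m) (Fin.last m) - 1).toNat = ℓ := by
      simp only [Pi.add_apply, Pi.smul_apply, lastVec_last, smul_eq_mul, mul_one]
      have : i (Fin.last m) = 1 := hp.2.2
      omega
    refine Prod.ext h1 ?_
    simp only
    rw [h1, add_sub_cancel_right]
  · intro i _
    simp

/-- For i in the wall, i - e_d is horizontal; translating by it carries the column over the origin
to the column through i and keeps all heights. A site and its mirror image carry the same field and
are therefore grouped together. -/
theorem wallPerturbation_eq (J lam : ℝ) (h : ℕ → ℝ) (n : ℕ) (σ : Config m) :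
    wallPerturbation J lam h n σ =
      J * ∑ i ∈ wallBox m n, wallPair m (shift (i - lastVec m) σ) -
        ∑ ℓ ∈ Finset.range n, addWall lam h (ℓ + 1) *
          ∑ i ∈ wallBox m n, layerPair m (ℓ + 1) (shift (i - lastVec m) σ) := by
  rw [wallPerturbation, sum_extendedField, sum_box, Finset.mul_sum]
  congr 1
  · refine Finset.sum_congr rfl fun i _ => ?_
    simp only [wallPair, spin_shift, add_sub_cancel, zero_add]
  · refine Finset.sum_congr rfl fun ℓ _ => ?_
    rw [Finset.mul_sum]
    refine Finset.sum_congr rfl fun i hi => ?_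
    rw [mem_wallBox] at hi
    have h1 : ((i + (ℓ : ℤ) • lastVec m) (Fin.last m)).toNat = ℓ + 1 := by
      simp only [Pi.add_apply, Pi.smul_apply, lastVec_last, smul_eq_mul, mul_one]
      omega
    have h2 : i + (ℓ : ℤ) • lastVec m = ((ℓ + 1 : ℕ) : ℤ) • lastVec m + (i - lastVec m) := by
      push_cast
      rw [add_smul, one_smul]
      abel
    have h3 : reflect (i + (ℓ : ℤ) • lastVec m) =
        -(((ℓ + 1 : ℕ) : ℤ) - 1) • lastVec m + (i - lastVec m) := by
      refine site_ext (fun k => ?_) ?_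
      · simp [reflect_castSucc, lastVec_castSucc]
      · simp only [reflect_last, Pi.add_apply, Pi.sub_apply, Pi.smul_apply, lastVec_last,
          smul_eq_mul, mul_one]
        push_cast
        omega
    rw [h1, h3, h2, layerPair, spin_shift, spin_shift]

/-- The derivative of the interpolated surface free energy, up to a factor `1 / 2`. -/
def surfaceIntegrand (m : ℕ) (ε : ℤˣ) (J lam : ℝ) (h : ℕ → ℝ) (n : ℕ) (t : ℝ) : ℝ :=
  J * wallAverage m ε J lam h n t (wallPair m) - ∑ ℓ ∈ Finset.range n,
    addWall lam h (ℓ + 1) * wallAverage m ε J lam h n t (layerPair m (ℓ + 1))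

theorem boxState_wallPerturbation (ε : ℤˣ) (J lam : ℝ) (h : ℕ → ℝ) (n : ℕ) (t : ℝ) :
    boxState m ε J lam h n t (wallPerturbation J lam h n) =
      (wallBox m n).card * surfaceIntegrand m ε J lam h n t := by
  have hne := (card_wallBox_pos (m := m) n).ne'
  have h1 : ∀ f : Config m → ℝ, ∑ i ∈ wallBox m n,
      boxState m ε J lam h n t (fun σ => f (shift (i - lastVec m) σ)) =
        (wallBox m n).card * wallAverage m ε J lam h n t f := fun f => by
    rw [wallAverage, mul_div_cancel₀ _ hne]
  rw [show (wallPerturbation J lam h n : Config m → ℝ) = _ from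
    funext fun σ => wallPerturbation_eq J lam h n σ]
  unfold boxState at h1 ⊢
  rw [gibbsExpectation_sub, gibbsExpectation_const_mul, gibbsExpectation_sum, gibbsExpectation_sum,
    h1, surfaceIntegrand, mul_sub, Finset.mul_sum]
  congr 1
  · ring
  · refine Finset.sum_congr rfl fun ℓ _ => ?_
    rw [gibbsExpectation_const_mul, gibbsExpectation_sum, h1]
    ring

theorem continuous_surfaceIntegrand (ε : ℤˣ) (J lam : ℝ) (h : ℕ → ℝ) (n : ℕ) :
    Continuous (surfaceIntegrand m ε J lam h n) :=
  ((continuous_wallAverage ε J lam h n _).const_mul _).sub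
    (continuous_finsetSum _ fun _ _ => (continuous_wallAverage ε J lam h n _).const_mul _)

/-- The fundamental theorem of calculus for ln Z(t), with end values ln Z_n² at t = 1 and ln Q_n at
t = 0. The factor |W_n| from the integrand cancels the normalisation. -/
theorem finiteSurfaceFreeEnergy_eq {n : ℕ} (hn : 1 ≤ n) (ε : ℤˣ) (J lam : ℝ) (h : ℕ → ℝ) :
    finiteSurfaceFreeEnergy m ε J lam h n =
      (1 / 2) * ∫ t in (0 : ℝ)..1, surfaceIntegrand m ε J lam h n t := by
  have hne := (card_wallBox_pos (m := m) n).ne'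
  have hint := intervalIntegral.integral_eq_sub_of_hasDerivAt (a := 0) (b := 1)
    (fun t _ => hasDerivAt_log_partitionFunction (doubleBox m n) (constConfig m ε)
      (isingHamiltonian (doubleBox m n) J (fun _ => 0)) (wallPerturbation J lam h n) t)
    ((continuous_gibbsExpectation _ _ _ _ _).neg.intervalIntegrable 0 1)
  have h1 : ∀ t, gibbsExpectation (doubleBox m n) (constConfig m ε)
      (fun σ => isingHamiltonian (doubleBox m n) J (fun _ => 0) σ
        + t * wallPerturbation J lam h n σ) (wallPerturbation J lam h n) =
      (wallBox m n).card * surfaceIntegrand m ε J lam h n t :=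
    boxState_wallPerturbation ε J lam h n
  simp only [h1, intervalIntegral.integral_neg, intervalIntegral.integral_const_mul] at hint
  rw [partitionFunction_interpolation_one hn] at hint
  simp only [zero_mul, add_zero] at hint
  rw [finiteSurfaceFreeEnergy, Real.log_div (pow_pos (partitionFunction_pos _ _ _) 2).ne'
    (partitionFunction_pos _ _ _).ne']
  rw [← hint]
  field_simp

/-! ### Passage to the limit under the sum and the integral. -/

/-- Bounded convergence of continuous functions on the unit interval. -/
theorem intervalIntegrable_and_tendsto_of_bounded {F : ℕ → ℝ → ℝ} {g : ℝ → ℝ} {C : ℝ}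
    (hF : ∀ n, Continuous (F n)) (hC : ∀ n, ∀ t ∈ Set.Icc (0 : ℝ) 1, |F n t| ≤ C)
    (hlim : ∀ t ∈ Set.Icc (0 : ℝ) 1, Tendsto (fun n => F n t) atTop (𝓝 (g t))) :
    IntervalIntegrable g volume 0 1 ∧
      Tendsto (fun n => ∫ t in (0 : ℝ)..1, F n t) atTop (𝓝 (∫ t in (0 : ℝ)..1, g t)) := by
  have hmem : ∀ t ∈ Set.uIoc (0 : ℝ) 1, t ∈ Set.Icc (0 : ℝ) 1 := fun t ht => by
    rw [Set.uIoc_of_le zero_le_one] at ht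
    exact Set.Ioc_subset_Icc_self ht
  have hae : ∀ᵐ t ∂(volume.restrict (Set.uIoc (0 : ℝ) 1)),
      Tendsto (fun n => F n t) atTop (𝓝 (g t)) :=
    (ae_restrict_iff' measurableSet_uIoc).2 (ae_of_all _ fun t ht => hlim t (hmem t ht))
  -- Continuity of the limit in t is not available; measurability is inherited from the continuous
  -- approximations.
  have hmeas : AEStronglyMeasurable g (volume.restrict (Set.uIoc (0 : ℝ) 1)) :=
    aestronglyMeasurable_of_tendsto_ae atTop (fun n => (hF n).aestronglyMeasurable) hae
  refine ⟨?_, ?_⟩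
  · refine (intervalIntegrable_const (c := C)).mono_fun hmeas ?_
    refine (ae_restrict_iff' measurableSet_uIoc).2 (ae_of_all _ fun t ht => ?_)
    change |g t| ≤ |C|
    exact (le_of_tendsto (hlim t (hmem t ht)).abs
      (Eventually.of_forall fun n => hC n t (hmem t ht))).trans (le_abs_self C)
  · refine intervalIntegral.tendsto_integral_filter_of_dominated_convergence (fun _ => C)
      (Eventually.of_forall fun n => (hF n).aestronglyMeasurable)
      (Eventually.of_forall fun n => ae_of_all _ fun t ht => hC n t (hmem t ht))
      intervalIntegrable_const (ae_of_all _ fun t ht => hlim t (hmem t ht))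

open scoped Classical in
theorem dependsOn_spin (i : Site m) : DependsOn (spin i) (({i} : Finset (Site m)) : Set (Site m)) :=
  fun σ σ' h => by rw [spin, h i (by simp), spin]

open scoped Classical in
theorem dependsOn_wallPair :
    DependsOn (wallPair m) (({lastVec m, 0} : Finset (Site m)) : Set (Site m)) :=
  fun σ σ' h => by
    rw [wallPair, wallPair, spin, spin, spin, spin, h _ (by simp), h 0 (by simp)]

open scoped Classical in
theorem dependsOn_layerPair (ℓ : ℕ) : DependsOn (layerPair m ℓ)
    (({(ℓ : ℤ) • lastVec m, -((ℓ : ℤ) - 1) • lastVec m} : Finset (Site m)) : Set (Site m)) :=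
  fun σ σ' h => by
    rw [layerPair, layerPair, spin, spin, spin, spin, h ((ℓ : ℤ) • lastVec m) (by simp),
      h (-((ℓ : ℤ) - 1) • lastVec m) (by simp)]

theorem abs_wallPair_le (σ : Config m) : |wallPair m σ| ≤ 1 := (abs_spin_mul_spin _ _ σ).le

theorem abs_layerPair_le (ℓ : ℕ) (σ : Config m) : |layerPair m ℓ σ| ≤ 2 := by
  refine (abs_add_le _ _).trans ?_
  rw [abs_spin, abs_spin]
  norm_num

theorem layerMagnetization_eq (ε : ℤˣ) {J : ℝ} (hJ : 0 ≤ J) (lam : ℝ) (h : ℕ → ℝ) (ℓ : ℕ) {t : ℝ}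
    (ht : t ≤ 1) :
    layerMagnetization m ε J lam h ℓ t = limitState m ε J lam h t (layerPair m ℓ) := by
  classical
  have h1 := (tendsto_boxState ε hJ lam h ht (dependsOn_spin ((ℓ : ℤ) • lastVec m))).add
    (tendsto_boxState ε hJ lam h ht (dependsOn_spin (-((ℓ : ℤ) - 1) • lastVec m)))
  refine tendsto_nhds_unique h1 ((tendsto_boxState ε hJ lam h ht
    (dependsOn_layerPair ℓ)).congr fun n => ?_)
  exact gibbsExpectation_add _ _ _ _ _

theorem summable_addWall {h : ℕ → ℝ} (hsum : Summable h) (lam : ℝ) : Summable (addWall lam h) :=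
  hsum.add (summable_of_ne_finset_zero (s := {1}) fun ℓ hℓ => if_neg (by simpa using hℓ))

theorem abs_layerMagnetization_le (ε : ℤˣ) {J : ℝ} (hJ : 0 ≤ J) (lam : ℝ) (h : ℕ → ℝ) (ℓ : ℕ)
    {t : ℝ} (ht : t ≤ 1) : |layerMagnetization m ε J lam h ℓ t| ≤ 2 := by
  classical
  rw [layerMagnetization_eq ε hJ lam h ℓ ht]
  exact le_of_tendsto (tendsto_boxState ε hJ lam h ht (dependsOn_layerPair ℓ)).abs
    (Eventually.of_forall fun n => abs_boxState_le ε J lam h n t (abs_layerPair_le ℓ))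

/-- The integrand of the limiting surface free energy, up to a factor `1 / 2`. -/
def limitIntegrand (m : ℕ) (ε : ℤˣ) (J lam : ℝ) (h : ℕ → ℝ) (t : ℝ) : ℝ :=
  J * wallCorrelation m ε J lam h t
    - ∑' ℓ : ℕ, addWall lam h (ℓ + 1) * layerMagnetization m ε J lam h (ℓ + 1) t

theorem tendsto_surfaceIntegrand (ε : ℤˣ) {J : ℝ} (hJ : 0 ≤ J) (lam : ℝ) {h : ℕ → ℝ}
    (hsum : Summable h) {t : ℝ} (ht : t ≤ 1) :
    Tendsto (fun n => surfaceIntegrand m ε J lam h n t) atTop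
      (𝓝 (limitIntegrand m ε J lam h t)) := by
  classical
  have hw : Tendsto (fun n => wallAverage m ε J lam h n t (wallPair m)) atTop
      (𝓝 (wallCorrelation m ε J lam h t)) := tendsto_wallAverage ε hJ lam h ht dependsOn_wallPair
  refine (hw.const_mul J).sub ?_
  have hbound : Summable fun ℓ : ℕ => |addWall lam h (ℓ + 1)| * 2 :=
    (((summable_nat_add_iff 1).2 (summable_addWall hsum lam)).abs).mul_right 2
  -- The finite sums over heights are extended by zero, so that each fixed layer is present once n >
  -- ℓ and 2|h'| dominates uniformly in n.
  have key := tendsto_tsum_of_dominated_convergence (𝓕 := atTop)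
    (f := fun (n : ℕ) (ℓ : ℕ) => if ℓ ∈ Finset.range n then
      addWall lam h (ℓ + 1) * wallAverage m ε J lam h n t (layerPair m (ℓ + 1)) else 0)
    (g := fun ℓ => addWall lam h (ℓ + 1) * layerMagnetization m ε J lam h (ℓ + 1) t) hbound
    (fun ℓ => ?_) (Eventually.of_forall fun n ℓ => ?_)
  · refine key.congr fun n => ?_
    rw [tsum_eq_sum (s := Finset.range n) fun ℓ hℓ => if_neg hℓ]
    exact Finset.sum_congr rfl fun ℓ hℓ => if_pos hℓ
  · rw [layerMagnetization_eq ε hJ lam h _ ht]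
    refine ((tendsto_wallAverage ε hJ lam h ht (dependsOn_layerPair (ℓ + 1))).const_mul
      (addWall lam h (ℓ + 1))).congr' ?_
    filter_upwards [eventually_gt_atTop ℓ] with n hn
    rw [if_pos (Finset.mem_range.2 hn)]
  · split_ifs
    · rw [Real.norm_eq_abs, abs_mul]
      exact mul_le_mul_of_nonneg_left (abs_wallAverage_le ε J lam h n t (abs_layerPair_le _))
        (abs_nonneg _)
    · rw [norm_zero]
      positivity

theorem abs_surfaceIntegrand_le (ε : ℤˣ) (J lam : ℝ) {h : ℕ → ℝ} (hsum : Summable h) (n : ℕ)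
    (t : ℝ) : |surfaceIntegrand m ε J lam h n t| ≤
      |J| + ∑' ℓ : ℕ, |addWall lam h (ℓ + 1)| * 2 := by
  have hbound : Summable fun ℓ : ℕ => |addWall lam h (ℓ + 1)| * 2 :=
    (((summable_nat_add_iff 1).2 (summable_addWall hsum lam)).abs).mul_right 2
  rw [surfaceIntegrand]
  refine (abs_sub _ _).trans (add_le_add ?_ ?_)
  · rw [abs_mul]
    exact mul_le_of_le_one_right (abs_nonneg _)
      (abs_wallAverage_le ε J lam h n t abs_wallPair_le)
  · refine (Finset.abs_sum_le_sum_abs _ _).trans ((Finset.sum_le_sum fun ℓ _ => ?_).trans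
      (hbound.sum_le_tsum _ fun ℓ _ => by positivity))
    rw [abs_mul]
    exact mul_le_mul_of_nonneg_left (abs_wallAverage_le ε J lam h n t (abs_layerPair_le _))
      (abs_nonneg _)

end

end SemiInfiniteIsing

theorem mainTheorem8 (m : ℕ) (J lam : ℝ) (hJ : 0 ≤ J) (hlam : 0 ≤ lam)
    (h : ℕ → ℝ) (hpos : ∀ ℓ, 1 ≤ ℓ → 0 < h ℓ) (hsum : Summable h) (ε : ℤˣ) :
    -- the surface free energy is well defined as a limit
    Tendsto (finiteSurfaceFreeEnergy m ε J lam h) atTop (𝓝 (surfaceFreeEnergy m ε J lam h)) ∧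
    -- the limiting state exists on all local functions
    (∀ t ∈ Set.Icc (0 : ℝ) 1, ∀ f : Config m → ℝ,
      (∃ A : Finset (Site m), DependsOn f (A : Set (Site m))) →
      Tendsto (fun n => boxState m ε J lam h n t f) atTop (𝓝 (limitState m ε J lam h t f))) ∧
    -- the terms of the two formulas are integrable and summable
    IntervalIntegrable (fun t => J * wallCorrelation m ε J lam h t) volume 0 1 ∧
    (∀ ℓ : ℕ, 1 ≤ ℓ → IntervalIntegrable
      (fun t => addWall lam h ℓ * layerMagnetization m ε J lam h ℓ t) volume 0 1) ∧
    Summable (fun ℓ : ℕ => ∫ t in (0 : ℝ)..1,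
      addWall lam h (ℓ + 1) * layerMagnetization m ε J lam h (ℓ + 1) t) ∧
    (∀ t ∈ Set.Icc (0 : ℝ) 1, Summable fun ℓ : ℕ =>
      addWall lam h (ℓ + 1) * layerMagnetization m ε J lam h (ℓ + 1) t) ∧
    IntervalIntegrable (fun t => J * wallCorrelation m ε J lam h t
      - ∑' ℓ : ℕ, addWall lam h (ℓ + 1) * layerMagnetization m ε J lam h (ℓ + 1) t) volume 0 1 ∧
    -- the surface free energy as an integral minus a series of integrals
    surfaceFreeEnergy m ε J lam h = (1 / 2) *
      ((∫ t in (0 : ℝ)..1, J * wallCorrelation m ε J lam h t)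
        - ∑' ℓ : ℕ, ∫ t in (0 : ℝ)..1,
            addWall lam h (ℓ + 1) * layerMagnetization m ε J lam h (ℓ + 1) t) ∧
    -- the surface free energy as a single integral
    surfaceFreeEnergy m ε J lam h = (1 / 2) *
      ∫ t in (0 : ℝ)..1, (J * wallCorrelation m ε J lam h t
        - ∑' ℓ : ℕ, addWall lam h (ℓ + 1) * layerMagnetization m ε J lam h (ℓ + 1) t) := by
  classical
  obtain ⟨hint, htend⟩ := intervalIntegrable_and_tendsto_of_bounded
    (F := surfaceIntegrand m ε J lam h) (g := limitIntegrand m ε J lam h)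
    (continuous_surfaceIntegrand ε J lam h)
    (fun n t _ => abs_surfaceIntegrand_le ε J lam hsum n t)
    (fun t ht => tendsto_surfaceIntegrand ε hJ lam hsum ht.2)
  have hF : Tendsto (finiteSurfaceFreeEnergy m ε J lam h) atTop
      (𝓝 ((1 / 2) * ∫ t in (0 : ℝ)..1, limitIntegrand m ε J lam h t)) := by
    refine (htend.const_mul (1 / 2)).congr' ?_
    filter_upwards [eventually_ge_atTop 1] with n hn
    exact (finiteSurfaceFreeEnergy_eq hn ε J lam h).symm
  have hlim : surfaceFreeEnergy m ε J lam h =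
      (1 / 2) * ∫ t in (0 : ℝ)..1, limitIntegrand m ε J lam h t := hF.limUnder_eq
  have hwall : IntervalIntegrable (fun t => wallCorrelation m ε J lam h t) volume 0 1 :=
    (intervalIntegrable_and_tendsto_of_bounded
      (fun n => continuous_boxState ε J lam h n (wallPair m))
      (fun n t _ => abs_boxState_le ε J lam h n t abs_wallPair_le)
      (fun t ht => tendsto_boxState ε hJ lam h ht.2 dependsOn_wallPair)).1
  have hlayer : ∀ ℓ, IntervalIntegrable (fun t => layerMagnetization m ε J lam h ℓ t)
      volume 0 1 := fun ℓ =>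
    (intervalIntegrable_and_tendsto_of_bounded
      (fun n => continuous_boxState ε J lam h n (layerPair m ℓ))
      (fun n t _ => abs_boxState_le ε J lam h n t (abs_layerPair_le ℓ))
      (fun t ht => by
        rw [layerMagnetization_eq ε hJ lam h ℓ ht.2]
        exact tendsto_boxState ε hJ lam h ht.2 (dependsOn_layerPair ℓ))).1
  have hbound : Summable fun ℓ : ℕ => |addWall lam h (ℓ + 1)| * 2 :=
    (((summable_nat_add_iff 1).2 (summable_addWall hsum lam)).abs).mul_right 2
  have hle : ∀ (ℓ : ℕ) (t : ℝ), t ≤ 1 →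
      ‖addWall lam h (ℓ + 1) * layerMagnetization m ε J lam h (ℓ + 1) t‖ ≤
        |addWall lam h (ℓ + 1)| * 2 := fun ℓ t ht => by
    rw [Real.norm_eq_abs, abs_mul]
    exact mul_le_mul_of_nonneg_left (abs_layerMagnetization_le ε hJ lam h _ ht) (abs_nonneg _)
  have hsumt : ∀ t ∈ Set.Icc (0 : ℝ) 1, Summable fun ℓ : ℕ =>
      addWall lam h (ℓ + 1) * layerMagnetization m ε J lam h (ℓ + 1) t := fun t ht =>
    Summable.of_norm_bounded hbound fun ℓ => hle ℓ t ht.2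
  have hmem : ∀ t ∈ Set.uIoc (0 : ℝ) 1, t ∈ Set.Icc (0 : ℝ) 1 := fun t ht => by
    rw [Set.uIoc_of_le zero_le_one] at ht
    exact Set.Ioc_subset_Icc_self ht
  -- Exchange of series and integral; the dominating terms do not depend on t and are summable. This
  -- links the two formulas.
  have hseries := intervalIntegral.hasSum_integral_of_dominated_convergence
    (μ := volume) (a := (0 : ℝ)) (b := 1)
    (F := fun (ℓ : ℕ) t => addWall lam h (ℓ + 1) * layerMagnetization m ε J lam h (ℓ + 1) t)
    (f := fun t => ∑' ℓ : ℕ, addWall lam h (ℓ + 1) * layerMagnetization m ε J lam h (ℓ + 1) t)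
    (fun (ℓ : ℕ) _ => |addWall lam h (ℓ + 1)| * 2)
    (fun ℓ => ((hlayer (ℓ + 1)).const_mul _).def'.aestronglyMeasurable)
    (fun ℓ => ae_of_all _ fun t ht => hle ℓ t (hmem t ht).2)
    (ae_of_all _ fun t _ => hbound) intervalIntegrable_const
    (ae_of_all _ fun t ht => (hsumt t (hmem t ht)).hasSum)
  have htsum : IntervalIntegrable (fun t => ∑' ℓ : ℕ,
      addWall lam h (ℓ + 1) * layerMagnetization m ε J lam h (ℓ + 1) t) volume 0 1 := by
    -- The series of magnetizations is the wall term minus the full integrand, both already known to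
    -- be integrable.
    refine ((hwall.const_mul J).sub hint).congr fun t _ => ?_
    simp [limitIntegrand]
  refine ⟨hlim ▸ hF, fun t ht f ⟨A, hA⟩ => tendsto_boxState ε hJ lam h ht.2 hA,
    hwall.const_mul J, fun ℓ _ => (hlayer ℓ).const_mul _, hseries.summable, hsumt, hint, ?_, hlim⟩
  rw [hlim, hseries.tsum_eq, ← intervalIntegral.integral_sub (hwall.const_mul J) htsum]
  rfl
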